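/- Let $n,m\in\{1,2,\dots\}$ and let $p(\cdot):\mathbb{R}^n\to(0,\infty)$ be a measurable function with $p_-:=\operatorname{ess\,inf}_{x\in\mathbb{R}^n}p(x)>0$ that is globally log-Hölder continuous, i.e. there are constants $C_0,C_\infty,p_\infty\in(0,\infty)$ such that $|p(x)-p(y)|\le -C_0/\log|x-y|$ whenever $|x-y|<\frac12$, and $|p(x)-p_\infty|\le C_\infty/\log(e+|x|)$ for all $x\in\mathbb{R}^n$. Put $\|f\|_{L^{p(\cdot)}}:=\inf\{\lambda\in(0,\infty):\int_{\mathbb{R}^n}|f(x)/\lambda|^{p(x)}\,dx\le1\}\in[0,\infty]$. A matrix weight is a function $W:\mathbb{R}^n\to M_m(\mathbb{C})$ with locally integrable entries such that $W(x)$ is nonnegative definite and invertible for almost every $x$. Cubes $Q\subset\mathbb{R}^n$ have edges parallel to the axes and edge length in $(0,\infty)$, $\lambda Q$ is the cube with the same center as $Q$ and $\lambda$ times its edge length, and $\|\cdot\|$ is the operator norm on $M_m(\mathbb{C})$ induced by the Euclidean norm. For a matrix weight $W$ and cubes $Q,R$ let $$\Phi_W(R,Q):=\exp\left(\frac1{|R|}\int_R\log\left(\frac{1}{\|\mathbf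 1_Q\|_{L^{p(\cdot)}}}\Big\|\,\|W(\cdot)W^{-1}(y)\|\,\mathbf 1_Q(\cdot)\Big\|_{L^{p(\cdot)}}\right)dy\right)\in[0,\infty],$$ with the integral understood in the extended sense. Write $W\in\mathscr{A}_{p(\cdot),\infty}$ if $\sup_Q\Phi_W(Q,Q)<\infty$, the supremum being taken over all cubes. For $d\in\mathbb{R}$, $W$ has $\mathscr{A}_{p(\cdot),\infty}$-lower dimension $d$ (written $W\in\mathbb{D}^{\rm lower}_{p(\cdot),\infty,d}$) if there is $C\in(0,\infty)$ with $\Phi_W(\lambda Q,Q)\le C\lambda^d$ for all $\lambda\in[1,\infty)$ and all cubes $Q$, and $\mathscr{A}_{p(\cdot),\infty}$-upper dimension $d$ (written $W\in\mathbb{D}^{\rm upper}_{p(\cdot),\infty,d}$) if there is $C\in(0,\infty)$ with $\Phi_W(Q,\lambda Q)\le C\lambda^d$ for all $\lambda\in[1,\infty)$ and all cubes $Q$. Then the following statements hold. (i) For every $d\in(-\infty,0)$, $\mathbb{D}^{\rm lower}_{p(\cdot),\infty,d}=\emptyset$ and $\mathbb{D}^{\rm upper}_{p(\cdot),\infty,d}=\emptyset$.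 (ii) For every $W\in\mathscr{A}_{p(\cdot),\infty}$ there exists $d_1\in[0,\frac{n}{p_-})$ such that $W\in\mathbb{D}^{\rm lower}_{p(\cdot),\infty,d_1}$. (iii) For every $W\in\mathscr{A}_{p(\cdot),\infty}$ there exists $d_2\in[0,\infty)$ such that $W\in\mathbb{D}^{\rm upper}_{p(\cdot),\infty,d_2}$. -/

import Mathlib

open MeasureTheory
open scoped ENNReal ComplexOrder

noncomputable section

/-- The closed cube `Q(x, l)` in `ℝⁿ` with centre `x`, edge length `l` and edges parallel to the
axes. (Adding or removing part of the boundary changes nothing below: only integrals over cubes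
occur.) The dilate `t Q(x, l)` is `cube x (t * l)`. -/
def cube {n : ℕ} (x : EuclideanSpace ℝ (Fin n)) (l : ℝ) : Set (EuclideanSpace ℝ (Fin n)) :=
  {y | ∀ i, |y i - x i| ≤ l / 2}

/-- Real-valued members of the class `𝒫₀`: measurable exponent functions `p > 0` with
`p₋ = ess inf p > 0`. -/
structure IsExponentP0 {n : ℕ} (p : EuclideanSpace ℝ (Fin n) → ℝ) : Prop where
  measurable : Measurable p
  pos : ∀ x, 0 < p x
  essInf_pos : 0 < essInf p volume

/-- Local log-Hölder continuity. (For `x = y` both sides of the inequality are `0`.) -/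
def IsLH0 {n : ℕ} (r : EuclideanSpace ℝ (Fin n) → ℝ) : Prop :=
  ∃ C₀ : ℝ, 0 < C₀ ∧ ∀ x y : EuclideanSpace ℝ (Fin n), ‖x - y‖ < 1 / 2 →
    |r x - r y| ≤ -C₀ / Real.log ‖x - y‖

/-- Log-Hölder continuity at infinity. -/
def IsLHInfty {n : ℕ} (r : EuclideanSpace ℝ (Fin n) → ℝ) : Prop :=
  ∃ rInf C : ℝ, 0 < rInf ∧ 0 < C ∧ ∀ x : EuclideanSpace ℝ (Fin n),
    |r x - rInf| ≤ C / Real.log (Real.exp 1 + ‖x‖)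

/-- Global log-Hölder continuity, `r(·) ∈ LH`. -/
def IsLH {n : ℕ} (r : EuclideanSpace ℝ (Fin n) → ℝ) : Prop :=
  IsLH0 r ∧ IsLHInfty r

/-- The variable exponent modular `∫ |f(x)|^{p(x)} dx`. -/
def modular {n : ℕ} (p f : EuclideanSpace ℝ (Fin n) → ℝ) : ℝ≥0∞ :=
  ∫⁻ x, ‖f x‖ₑ ^ p x

/-- The Luxemburg (quasi-)norm of `L^{p(·)}`, with value `∞` outside of `L^{p(·)}`. -/
def varNorm {n : ℕ} (p f : EuclideanSpace ℝ (Fin n) → ℝ) : ℝ≥0∞ :=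
  sInf {a : ℝ≥0∞ | ∃ s : ℝ, 0 < s ∧ modular p (fun x => f x / s) ≤ 1 ∧ a = ENNReal.ofReal s}

/-- The operator norm of a complex matrix with respect to the Euclidean norm of `ℂᵐ`. -/
def opNorm {m : ℕ} (A : Matrix (Fin m) (Fin m) ℂ) : ℝ :=
  ‖Matrix.toEuclideanCLM (n := Fin m) (𝕜 := ℂ) A‖

/-- `exp (⨍_Q log f)` for `f` with values in `[0, ∞]`. The integral of `log f` is the extended one,
(integral of the positive part) - (integral of the negative part); it is read as `+∞` if both
parts have an infinite integral. -/
def geomMean {n : ℕ} (Q : Set (EuclideanSpace ℝ (Fin n)))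
    (f : EuclideanSpace ℝ (Fin n) → ℝ≥0∞) : ℝ≥0∞ :=
  EReal.exp (-(((⨍⁻ y in Q, (-ENNReal.log (f y)).toENNReal ∂volume : ℝ≥0∞) : EReal) -
    ((⨍⁻ y in Q, (ENNReal.log (f y)).toENNReal ∂volume : ℝ≥0∞) : EReal)))

/-- Matrix weights. -/
structure IsMatrixWeight {n m : ℕ}
    (W : EuclideanSpace ℝ (Fin n) → Matrix (Fin m) (Fin m) ℂ) : Prop where
  nonneg : ∀ᵐ x, (W x).PosSemidef
  invertible : ∀ᵐ x, IsUnit (W x)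
  locallyIntegrable : ∀ i j, LocallyIntegrable (fun x => W x i j) volume

/-- The normalized quantity
`‖𝟏_Q‖_{L^{p(·)}}⁻¹ ‖ ‖W(·) W⁻¹(y)‖ 𝟏_Q(·) ‖_{L^{p(·)}}`, as a function of `y`. -/
def avgNorm {n m : ℕ} (p : EuclideanSpace ℝ (Fin n) → ℝ)
    (W : EuclideanSpace ℝ (Fin n) → Matrix (Fin m) (Fin m) ℂ)
    (Q : Set (EuclideanSpace ℝ (Fin n))) (y : EuclideanSpace ℝ (Fin n)) : ℝ≥0∞ :=
  varNorm p (Q.indicator fun x => opNorm (W x * (W y)⁻¹)) / varNorm p (Q.indicator fun _ => 1)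

/-- The constant `[W]_{𝒜_{p(·),∞}}`, in `[0, ∞]`. -/
def apInftyConst {n m : ℕ} (p : EuclideanSpace ℝ (Fin n) → ℝ)
    (W : EuclideanSpace ℝ (Fin n) → Matrix (Fin m) (Fin m) ℂ) : ℝ≥0∞ :=
  ⨆ (x : EuclideanSpace ℝ (Fin n)) (l : ℝ) (_ : 0 < l),
    geomMean (cube x l) (avgNorm p W (cube x l))

/-- The class of matrix `𝒜_{p(·),∞}` weights. -/
def ApInfty {n : ℕ} (m : ℕ) (p : EuclideanSpace ℝ (Fin n) → ℝ) :
    Set (EuclideanSpace ℝ (Fin n) → Matrix (Fin m) (Fin m) ℂ) :=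
  {W | IsMatrixWeight W ∧ apInftyConst p W < ∞}

/-- The matrix weights of `𝒜_{p(·),∞}`-lower dimension `d`. -/
def LowerDim {n : ℕ} (m : ℕ) (p : EuclideanSpace ℝ (Fin n) → ℝ) (d : ℝ) :
    Set (EuclideanSpace ℝ (Fin n) → Matrix (Fin m) (Fin m) ℂ) :=
  {W | IsMatrixWeight W ∧ ∃ C : ℝ, 0 < C ∧
    ∀ (t : ℝ) (x : EuclideanSpace ℝ (Fin n)) (l : ℝ), 1 ≤ t → 0 < l →
      geomMean (cube x (t * l)) (avgNorm p W (cube x l)) ≤ ENNReal.ofReal (C * t ^ d)}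

/-- The matrix weights of `𝒜_{p(·),∞}`-upper dimension `d`. -/
def UpperDim {n : ℕ} (m : ℕ) (p : EuclideanSpace ℝ (Fin n) → ℝ) (d : ℝ) :
    Set (EuclideanSpace ℝ (Fin n) → Matrix (Fin m) (Fin m) ℂ) :=
  {W | IsMatrixWeight W ∧ ∃ C : ℝ, 0 < C ∧
    ∀ (t : ℝ) (x : EuclideanSpace ℝ (Fin n)) (l : ℝ), 1 ≤ t → 0 < l →
      geomMean (cube x l) (avgNorm p W (cube x (t * l))) ≤ ENNReal.ofReal (C * t ^ d)}

end

/-! ### Geometry and volume of cubes. -/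

section Cubes

variable {n : ℕ}

/-! The matrix problem reduces to scalar weights `w_M = ‖W(·)M‖`, `M` invertible. From `W(x)M =
(W(x)W(y)⁻¹)(W(y)M)` one gets `‖w_M 𝟏_Q‖ ≤ w_M(y) ‖w_{W(y)⁻¹} 𝟏_Q‖`. Taking geometric means over `y
∈ Q` shows that every `w_M` is a scalar `𝒜_{p(·),∞}` weight with the constant of `W`
(`isScalarApInfty_opNorm_mul`). Conversely, `avgNorm p W Q y` is the normalized norm of `w_M` for `M
= W(y)⁻¹`, so a scalar comparison of `Q` with `tQ` that is uniform in the weight holds for each `y`;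
averaging over the cube on which the geometric mean is controlled by the weight constant
(`geomMean_avgNorm_le`) gives the dimensions.

The scalar theory rests on a Jensen inequality (`CubeRegular.setIntegral_log_le`): if `E ⊆ Q` fills
a fixed fraction of `Q`, then `exp(⨍_E log u)` times a power of `|Q|` comparable to `‖𝟏_Q‖` is at
most a constant times `‖u 𝟏_E‖`. Log-Hölder continuity makes the constant independent of the cube.
Since the weight condition bounds `‖w 𝟏_Q‖` by `exp(⨍_Q log w) ‖𝟏_Q‖`, splitting `5Q` into a subcube
and its complement yields doubling, hence an upper dimension. Doubling also gives a disjoint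
neighbour of `Q` inside `5Q` a definite share of the modular, so `‖w 𝟏_Q‖ ≤ e⁻ᵉ ‖w 𝟏_{5Q}‖` for some
`e > 0`. Against `‖𝟏_{tQ}‖ ≲ t^{n/p₋} ‖𝟏_Q‖`, this gain puts the lower dimension strictly below
`n/p₋`.

For `d < 0`, the case `t = 1` already forces the `𝒜_{p(·),∞}` condition, so `log ‖W‖` is locally
integrable. At one of its Lebesgue points `x`, compare the cubes of edges `t⁻¹` and `1` centred at
`x`: the geometric means stay bounded away from `0` as `t → ∞`, while `t^d → 0`. -/

theorem cube_eq_preimage (x : EuclideanSpace ℝ (Fin n)) (l : ℝ) :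
    cube x l = (MeasurableEquiv.toLp 2 (Fin n → ℝ)).symm ⁻¹'
      Set.Icc (fun i => x i - l / 2) (fun i => x i + l / 2) := by
  ext y
  simp only [cube, Set.mem_ofPred_eq, Set.mem_preimage, Set.mem_Icc, Pi.le_def, ← forall_and,
    abs_le]
  refine forall_congr' fun i => ?_
  simp only [MeasurableEquiv.coe_toLp_symm]
  constructor <;> rintro ⟨h1, h2⟩ <;> constructor <;> linarith

theorem measurableSet_cube (x : EuclideanSpace ℝ (Fin n)) (l : ℝ) :
    MeasurableSet (cube x l) := by
  rw [cube_eq_preimage]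
  exact (MeasurableEquiv.measurable _) measurableSet_Icc

theorem volume_cube (x : EuclideanSpace ℝ (Fin n)) {l : ℝ} (hl : 0 ≤ l) :
    volume (cube x l) = ENNReal.ofReal (l ^ n) := by
  rw [cube_eq_preimage, (EuclideanSpace.volume_preserving_symm_measurableEquiv_toLp
    (Fin n)).measure_preimage measurableSet_Icc.nullMeasurableSet, Real.volume_Icc_pi]
  have : ∀ i, x i + l / 2 - (x i - l / 2) = l := fun i => by ring
  simp [this, ENNReal.ofReal_pow hl]

theorem volume_real_cube (x : EuclideanSpace ℝ (Fin n)) {l : ℝ} (hl : 0 ≤ l) :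
    volume.real (cube x l) = l ^ n := by
  rw [Measure.real, volume_cube x hl, ENNReal.toReal_ofReal (by positivity)]

theorem volume_cube_ne_top (x : EuclideanSpace ℝ (Fin n)) {l : ℝ} (hl : 0 ≤ l) :
    volume (cube x l) ≠ ∞ := by
  rw [volume_cube x hl]; exact ENNReal.ofReal_ne_top

theorem cube_subset_cube {x y : EuclideanSpace ℝ (Fin n)} {l r : ℝ}
    (h : ∀ i, |x i - y i| + l / 2 ≤ r / 2) : cube x l ⊆ cube y r := by
  intro z hz i
  have h1 := hz i
  have h2 := abs_sub_le (z i) (x i) (y i)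
  have h3 := h i
  linarith

theorem cube_mono (x : EuclideanSpace ℝ (Fin n)) {l r : ℝ} (h : l ≤ r) :
    cube x l ⊆ cube x r :=
  cube_subset_cube fun i => by simp; linarith

theorem norm_sub_le_of_mem_cube {x y : EuclideanSpace ℝ (Fin n)} {l : ℝ} (hl : 0 ≤ l)
    (h : y ∈ cube x l) : ‖y - x‖ ≤ n * l := by
  rw [EuclideanSpace.norm_eq]
  apply Real.sqrt_le_iff.2 ⟨by positivity, ?_⟩
  have h1 : ∑ i, ‖(y - x) i‖ ^ 2 ≤ ∑ _i : Fin n, l ^ 2 := by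
    refine Finset.sum_le_sum fun i _ => ?_
    have := h i
    simp only [PiLp.sub_apply, Real.norm_eq_abs]
    exact pow_le_pow_left₀ (abs_nonneg _) (by linarith) 2
  refine h1.trans ?_
  simp only [Finset.sum_const, Finset.card_univ, Fintype.card_fin, nsmul_eq_mul]
  rw [mul_pow]
  have : (n : ℝ) ≤ (n : ℝ) ^ 2 := by
    exact_mod_cast Nat.le_self_pow two_ne_zero n
  exact mul_le_mul_of_nonneg_right this (by positivity)

theorem mem_cube_zero_of_norm_lt {y : EuclideanSpace ℝ (Fin n)} {r : ℝ} (h : ‖y‖ < r) :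
    y ∈ cube 0 (2 * r) := by
  intro i
  have := PiLp.norm_apply_le y i
  simp only [PiLp.zero_apply, sub_zero]
  rw [Real.norm_eq_abs] at this
  linarith

end Cubes

/-! ### The modular and the Luxemburg quasi-norm. -/

section VarNorm

variable {n : ℕ} {p : EuclideanSpace ℝ (Fin n) → ℝ}

theorem modular_mono {f g : EuclideanSpace ℝ (Fin n) → ℝ} (hp : ∀ x, 0 < p x)
    (h : ∀ᵐ x, |f x| ≤ |g x|) : modular p f ≤ modular p g := by
  refine lintegral_mono_ae (h.mono fun x hx => ?_)
  refine ENNReal.rpow_le_rpow ?_ (hp x).le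
  rw [Real.enorm_eq_ofReal_abs, Real.enorm_eq_ofReal_abs]
  exact ENNReal.ofReal_le_ofReal hx

theorem modular_const_mul_le {f : EuclideanSpace ℝ (Fin n) → ℝ} (hp : ∀ x, 0 < p x) {c D : ℝ}
    (hc : 0 < c) (hD : ∀ x, c ^ p x ≤ D) :
    modular p (fun x => c * f x) ≤ ENNReal.ofReal D * modular p f := by
  unfold modular
  rw [← lintegral_const_mul' _ _ ENNReal.ofReal_ne_top]
  refine lintegral_mono fun x => ?_
  simp only [enorm_mul]
  rw [ENNReal.mul_rpow_of_nonneg _ _ (hp x).le, Real.enorm_eq_ofReal_abs, abs_of_pos hc,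
    ENNReal.ofReal_rpow_of_pos hc]
  gcongr
  exact hD x

theorem varNorm_le {f : EuclideanSpace ℝ (Fin n) → ℝ} {s : ℝ} (hs : 0 < s)
    (h : modular p (fun x => f x / s) ≤ 1) : varNorm p f ≤ ENNReal.ofReal s :=
  sInf_le ⟨s, hs, h, rfl⟩

theorem modular_div_antitone {f : EuclideanSpace ℝ (Fin n) → ℝ} (hp : ∀ x, 0 < p x) {s t : ℝ}
    (hs : 0 < s) (hst : s ≤ t) :
    modular p (fun x => f x / t) ≤ modular p (fun x => f x / s) := by
  refine modular_mono hp (Filter.Eventually.of_forall fun x => ?_)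
  rw [abs_div, abs_div, abs_of_pos hs, abs_of_pos (hs.trans_le hst)]
  gcongr

theorem modular_le_one_of_lt {f : EuclideanSpace ℝ (Fin n) → ℝ} (hp : ∀ x, 0 < p x) {s : ℝ}
    (h : varNorm p f < ENNReal.ofReal s) : modular p (fun x => f x / s) ≤ 1 := by
  obtain ⟨a, ⟨t, ht, hm, rfl⟩, hts⟩ := sInf_lt_iff.1 h
  exact (modular_div_antitone hp ht (ENNReal.ofReal_lt_ofReal_iff'.1 hts).1.le).trans hm

theorem le_varNorm {f : EuclideanSpace ℝ (Fin n) → ℝ} {a : ℝ}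
    (h : ∀ s, 0 < s → modular p (fun x => f x / s) ≤ 1 → a ≤ s) :
    ENNReal.ofReal a ≤ varNorm p f := by
  refine le_sInf ?_
  rintro _ ⟨s, hs, hm, rfl⟩
  exact ENNReal.ofReal_le_ofReal (h s hs hm)

theorem varNorm_mono {f g : EuclideanSpace ℝ (Fin n) → ℝ} (hp : ∀ x, 0 < p x)
    (h : ∀ᵐ x, |f x| ≤ |g x|) : varNorm p f ≤ varNorm p g := by
  refine le_sInf ?_
  rintro _ ⟨s, hs, hm, rfl⟩
  refine varNorm_le hs ((modular_mono hp (h.mono fun x hx => ?_)).trans hm)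
  rw [abs_div, abs_div]
  gcongr

theorem varNorm_indicator_mono {f : EuclideanSpace ℝ (Fin n) → ℝ} (hp : ∀ x, 0 < p x)
    {S T : Set (EuclideanSpace ℝ (Fin n))} (h : S ⊆ T) :
    varNorm p (S.indicator f) ≤ varNorm p (T.indicator f) := by
  refine varNorm_mono hp (Filter.Eventually.of_forall fun x => ?_)
  by_cases hx : x ∈ S
  · simp [hx, h hx]
  · simp [hx]

theorem varNorm_const_mul_le {f : EuclideanSpace ℝ (Fin n) → ℝ} {c : ℝ} (hc : 0 < c) :
    varNorm p (fun x => c * f x) ≤ ENNReal.ofReal c * varNorm p f := by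
  rw [mul_comm, ← ENNReal.div_le_iff_le_mul (Or.inl (by simpa using hc)) (Or.inl ENNReal.ofReal_ne_top)]
  refine le_sInf ?_
  rintro _ ⟨s, hs, hm, rfl⟩
  rw [ENNReal.div_le_iff_le_mul (Or.inl (by simpa using hc)) (Or.inl ENNReal.ofReal_ne_top),
    ← ENNReal.ofReal_mul hs.le]
  refine sInf_le ⟨s * c, by positivity, ?_, rfl⟩
  convert hm using 3 with x
  field_simp

theorem modular_indicator (hp : ∀ x, 0 < p x) {S : Set (EuclideanSpace ℝ (Fin n))}
    (hS : MeasurableSet S) (f : EuclideanSpace ℝ (Fin n) → ℝ) (s : ℝ) :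
    modular p (fun x => S.indicator f x / s) = ∫⁻ x in S, ‖f x / s‖ₑ ^ p x := by
  rw [modular, ← lintegral_indicator hS]
  refine lintegral_congr fun x => ?_
  by_cases hx : x ∈ S
  · simp [hx]
  · simp [hx, hp x]

/-- If the modular is at most `D ≥ 1`, then the quasi-norm is at most `D ^ (1 / a)`, where `a` is a
lower bound of the exponent. -/
theorem varNorm_le_of_modular_le {f : EuclideanSpace ℝ (Fin n) → ℝ} {a D s : ℝ} (ha : 0 < a)
    (hp : ∀ x, a ≤ p x) (hs : 0 < s) (hD : 1 ≤ D)
    (h : modular p (fun x => f x / s) ≤ ENNReal.ofReal D) :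
    varNorm p f ≤ ENNReal.ofReal (D ^ (1 / a) * s) := by
  have hD0 : 0 < D := by linarith
  have hc : 0 < D ^ (-(1 / a)) := by positivity
  refine varNorm_le (by positivity) ?_
  have h1 := modular_const_mul_le (f := fun x => f x / s) (D := D⁻¹)
    (fun x => ha.trans_le (hp x)) hc (fun x => ?_)
  · have h2 : (fun x => D ^ (-(1 / a)) * (f x / s)) = fun x => f x / (D ^ (1 / a) * s) := by
      ext x
      rw [Real.rpow_neg hD0.le]
      field_simp
    rw [h2] at h1
    refine h1.trans ?_
    calc _ ≤ ENNReal.ofReal D⁻¹ * ENNReal.ofReal D := by gcongr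
      _ = 1 := by
        rw [← ENNReal.ofReal_mul (by positivity), inv_mul_cancel₀ hD0.ne', ENNReal.ofReal_one]
  · rw [← Real.rpow_mul hD0.le, ← Real.rpow_neg_one]
    refine Real.rpow_le_rpow_of_exponent_le hD ?_
    have := (one_le_div ha).2 (hp x)
    calc -(1 / a) * p x = -(p x / a) := by ring
      _ ≤ -1 := by linarith

/-- If the modular is at most `D ≤ 1`, then the quasi-norm is at most `D ^ (1 / b)`, where `b` is an
upper bound of the exponent. -/
theorem varNorm_le_of_modular_le' {f : EuclideanSpace ℝ (Fin n) → ℝ} {b D s : ℝ}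
    (hp0 : ∀ x, 0 < p x) (hb : 0 < b)
    (hp : ∀ x, p x ≤ b) (hs : 0 < s) (hD0 : 0 < D) (hD : D ≤ 1)
    (h : modular p (fun x => f x / s) ≤ ENNReal.ofReal D) :
    varNorm p f ≤ ENNReal.ofReal (D ^ (1 / b) * s) := by
  have hc : 0 < D ^ (-(1 / b)) := by positivity
  refine varNorm_le (by positivity) ?_
  have h1 := modular_const_mul_le (f := fun x => f x / s) (D := D⁻¹) hp0 hc (fun x => ?_)
  · have h2 : (fun x => D ^ (-(1 / b)) * (f x / s)) = fun x => f x / (D ^ (1 / b) * s) := by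
      ext x
      rw [Real.rpow_neg hD0.le]
      field_simp
    rw [h2] at h1
    refine h1.trans ?_
    calc _ ≤ ENNReal.ofReal D⁻¹ * ENNReal.ofReal D := by gcongr
      _ = 1 := by
        rw [← ENNReal.ofReal_mul (by positivity), inv_mul_cancel₀ hD0.ne', ENNReal.ofReal_one]
  · rw [← Real.rpow_mul hD0.le, ← Real.rpow_neg_one]
    refine Real.rpow_le_rpow_of_exponent_ge hD0 hD ?_
    have := (div_le_one hb).2 (hp x)
    calc -1 ≤ -(p x / b) := by linarith
      _ = -(1 / b) * p x := by ring

/-- A lower bound of the quasi-norm by `c ≤ 1` bounds the modular below by `c ^ b`, where `b` is an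
upper bound of the exponent. -/
theorem le_modular_of_lt_varNorm {f : EuclideanSpace ℝ (Fin n) → ℝ} {b c s : ℝ}
    (hp0 : ∀ x, 0 < p x) (hp : ∀ x, p x ≤ b) (hs : 0 < s) (hc0 : 0 < c) (hc : c ≤ 1)
    (h : ENNReal.ofReal (c * s) < varNorm p f) :
    ENNReal.ofReal (c ^ b) ≤ modular p (fun x => f x / s) := by
  have h0 : 1 < modular p (fun x => f x / (c * s)) := by
    by_contra hcon
    exact absurd (varNorm_le (by positivity) (not_lt.1 hcon)) (not_le.2 h)
  have h1 := modular_const_mul_le (f := fun x => f x / s) (c := c⁻¹) (D := c⁻¹ ^ b) hp0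
    (by positivity) (fun x => Real.rpow_le_rpow_of_exponent_le (one_le_inv_iff₀.2 ⟨hc0, hc⟩) (hp x))
  have h2 : (fun x => c⁻¹ * (f x / s)) = fun x => f x / (c * s) := by
    ext x
    field_simp
  rw [h2] at h1
  have h3 := h0.le.trans h1
  rw [Real.inv_rpow hc0.le, ENNReal.ofReal_inv_of_pos (by positivity)] at h3
  calc ENNReal.ofReal (c ^ b) = ENNReal.ofReal (c ^ b) * 1 := by simp
    _ ≤ ENNReal.ofReal (c ^ b) * ((ENNReal.ofReal (c ^ b))⁻¹ * _) := by gcongr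
    _ = _ := by
      rw [← mul_assoc, ENNReal.mul_inv_cancel (by simp; positivity) ENNReal.ofReal_ne_top, one_mul]

end VarNorm

/-! ### Consequences of log-Hölder continuity on cubes. -/

section Exponent

variable {n : ℕ} {p : EuclideanSpace ℝ (Fin n) → ℝ}

/-- The modulus `-C / log ‖x - y‖` tends to `0` because the logarithm tends to `-∞`. Continuity is
what turns almost everywhere bounds on the exponent into bounds at every point. -/
theorem IsLH0.continuous (h : IsLH0 p) : Continuous p := by
  obtain ⟨C, hC, h⟩ := h
  refine continuous_iff_continuousAt.2 fun x => ?_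
  rw [ContinuousAt, tendsto_iff_dist_tendsto_zero]
  have h1 : Filter.Tendsto (fun y => ‖y - x‖) (nhdsWithin x {x}ᶜ) (nhdsWithin 0 (Set.Ioi 0)) := by
    have := tendsto_norm_sub_self_nhdsNE x
    exact this
  have h2 : Filter.Tendsto (fun y => -C / Real.log ‖y - x‖) (nhdsWithin x {x}ᶜ) (nhds 0) :=
    (Real.tendsto_log_nhdsGT_zero.comp h1).const_div_atBot (-C)
  have h3 : ∀ᶠ y in nhdsWithin x {x}ᶜ, ‖y - x‖ < 1 / 2 :=
    nhdsWithin_le_nhds (by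
      have := Metric.ball_mem_nhds x (ε := 1 / 2) (by norm_num)
      filter_upwards [this] with y hy
      rwa [mem_ball_iff_norm] at hy)
  have h4 : Filter.Tendsto (fun y => dist (p y) (p x)) (nhdsWithin x {x}ᶜ) (nhds 0) := by
    refine squeeze_zero' (Filter.Eventually.of_forall fun y => dist_nonneg) ?_ h2
    filter_upwards [h3] with y hy
    exact h y x hy
  rw [← nhdsNE_sup_pure, Filter.tendsto_sup]
  exact ⟨h4, by simpa using (tendsto_pure_nhds (fun y => dist (p y) (p x)) x)⟩

/-- The set where `p` falls below its essential infimum is open and null, hence empty. -/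
theorem IsExponentP0.essInf_le (hp : IsExponentP0 p) (hc : Continuous p)
    (x : EuclideanSpace ℝ (Fin n)) : essInf p volume ≤ p x := by
  have hbdd : Filter.IsBoundedUnder (fun a b => a ≥ b) (ae volume) p :=
    ⟨0, Filter.eventually_map.2 (Filter.Eventually.of_forall fun x => (hp.pos x).le)⟩
  have h1 : ∀ᵐ y, essInf p volume ≤ p y := ae_essInf_le hbdd
  by_contra! hx
  have hU : IsOpen {y | p y < essInf p volume} := isOpen_lt hc continuous_const
  have h0 : volume {y | p y < essInf p volume} = 0 := by
    rw [ae_iff] at h1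
    simpa using h1
  rw [hU.measure_eq_zero_iff volume] at h0
  exact (h0 ▸ hx : x ∈ (∅ : Set _))

/-- The local exponents: the value at the centre for small cubes and the limit at infinity for
large cubes. -/
noncomputable def localExponent (p : EuclideanSpace ℝ (Fin n) → ℝ) (pInf : ℝ) (x : EuclideanSpace ℝ (Fin n))
    (l : ℝ) : ℝ :=
  if l ≤ 1 then 1 / p x else 1 / pInf

/-- Bounds for an exponent together with the consequences of log-Hölder continuity on cubes:
on the cube `Q` of centre `x` and edge length `l`, the reciprocal exponent deviates from
`q x l` by `O(1 / |log l|)` on average, and `‖𝟏_Q‖ ≲ |Q| ^ q x l`. -/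
structure CubeRegular (p : EuclideanSpace ℝ (Fin n) → ℝ) (a b C : ℝ)
    (q : EuclideanSpace ℝ (Fin n) → ℝ → ℝ) : Prop where
  measurable : Measurable p
  lower_pos : 0 < a
  lower_le : ∀ x, a ≤ p x
  le_upper : ∀ x, p x ≤ b
  one_le_const : 1 ≤ C
  q_le : ∀ x l, q x l ≤ 1 / a
  q_small : ∀ x l r, l ≤ 1 → r ≤ 1 → q x l = q x r
  q_large : ∀ x l r, 1 < l → 1 < r → q x l = q x r
  oscillation : ∀ x l, 0 < l →
    ∫⁻ y in cube x l, ENNReal.ofReal (|1 / p y - q x l| * |Real.log l|) ≤ ENNReal.ofReal (C * l ^ n)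
  modular_le : ∀ x l, 0 < l →
    ∫⁻ y in cube x l, ENNReal.ofReal (Real.exp (-(n * q x l * p y * Real.log l))) ≤ ENNReal.ofReal C

/-- `B` is the exceptional set carrying the crude bound: empty for small cubes, a cube around the
origin for large ones. -/
theorem setLIntegral_le_of_le_add_indicator {f : EuclideanSpace ℝ (Fin n) → ℝ}
    {Q B : Set (EuclideanSpace ℝ (Fin n))} {c d : ℝ} (hQ : MeasurableSet Q) (hB : MeasurableSet B)
    (hf1 : ∀ y ∈ Q, y ∉ B → f y ≤ c) (hf2 : ∀ y ∈ Q, y ∈ B → f y ≤ d) :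
    ∫⁻ y in Q, ENNReal.ofReal (f y) ≤
      ENNReal.ofReal c * volume Q + ENNReal.ofReal d * volume B := by
  rw [← lintegral_inter_add_sdiff _ Q hB, add_comm]
  refine add_le_add ?_ ?_
  · calc _ ≤ ∫⁻ y in Q \ B, ENNReal.ofReal c := by
          refine setLIntegral_mono' (hQ.diff hB) fun y hy => ?_
          exact ENNReal.ofReal_le_ofReal (hf1 y hy.1 hy.2)
      _ ≤ _ := by
          rw [setLIntegral_const]
          gcongr
          exact Set.sdiff_subset
  · calc _ ≤ ∫⁻ y in Q ∩ B, ENNReal.ofReal d := by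
          refine setLIntegral_mono' (hQ.inter hB) fun y hy => ?_
          exact ENNReal.ofReal_le_ofReal (hf2 y hy.1 hy.2)
      _ ≤ _ := by
          rw [setLIntegral_const]
          gcongr
          exact Set.inter_subset_right

theorem IsLH0.exists_osc_le (h : IsLH0 p) {b : ℝ} (h0 : ∀ x, 0 ≤ p x) (hb : ∀ x, p x ≤ b) :
    ∃ C, 0 < C ∧ ∀ x l, 0 < l → l ≤ 1 → ∀ y ∈ cube x l, |p y - p x| * |Real.log l| ≤ C := by
  obtain ⟨C₀, hC₀, h⟩ := h
  -- The threshold `1 / (5 + n²)` serves twice: `n² l ≤ 1` gives `n l ≤ √l`, and `l ≤ 1/5` gives `√l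
  -- < 1/2`. Below it, `|log ‖y - x‖| ≥ |log l| / 2`; above it, `|log l|` is bounded and boundedness
  -- of `p` suffices.
  have hN : (0 : ℝ) < 5 + n ^ 2 := by positivity
  have hlogN : 0 < Real.log (5 + (n : ℝ) ^ 2) := Real.log_pos (by nlinarith [sq_nonneg (n : ℝ)])
  have hb0 : 0 ≤ b := (h0 0).trans (hb 0)
  refine ⟨2 * C₀ + b * Real.log (5 + n ^ 2), by positivity, fun x l hl hl1 y hy => ?_⟩
  have hlog : Real.log l ≤ 0 := Real.log_nonpos hl.le hl1
  rcases le_total ((5 + (n : ℝ) ^ 2)⁻¹) l with hc | hc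
  · have h1 : |Real.log l| ≤ Real.log (5 + n ^ 2) := by
      rw [abs_of_nonpos hlog, ← Real.log_inv]
      refine Real.log_le_log (by positivity) ?_
      rw [inv_le_comm₀ hl hN]
      exact hc
    have h2 : |p y - p x| ≤ b := by
      rw [abs_le]
      constructor <;> linarith [h0 x, h0 y, hb x, hb y]
    calc |p y - p x| * |Real.log l| ≤ b * Real.log (5 + n ^ 2) := by gcongr
      _ ≤ _ := by linarith
  · have hle : l * (5 + (n : ℝ) ^ 2) ≤ 1 := by
      rw [le_inv_comm₀ hl hN] at hc
      calc _ ≤ l * l⁻¹ := by gcongr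
        _ = 1 := mul_inv_cancel₀ hl.ne'
    have h5 : l ≤ 1 / 5 := by nlinarith [mul_nonneg hl.le (sq_nonneg (n : ℝ))]
    have hnl : n * l ≤ √l := by
      apply Real.le_sqrt_of_sq_le
      nlinarith
    have hs : √l < 1 / 2 := by
      rw [Real.sqrt_lt' (by norm_num)]
      linarith
    have hyx := (norm_sub_le_of_mem_cube hl.le hy).trans hnl
    have hlogneg : Real.log l < 0 := Real.log_neg hl (by linarith)
    rcases eq_or_ne y x with rfl | hne
    · simp; positivity
    have hpos : 0 < ‖y - x‖ := norm_pos_iff.2 (sub_ne_zero.2 hne)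
    have h1 := h y x (hyx.trans_lt hs)
    have h2 : Real.log ‖y - x‖ ≤ Real.log l / 2 := by
      rw [← Real.log_sqrt hl.le]
      exact Real.log_le_log hpos hyx
    have h3 : -C₀ / Real.log ‖y - x‖ ≤ 2 * C₀ / |Real.log l| := by
      rw [abs_of_neg hlogneg, neg_div, ← div_neg, div_le_div_iff₀ (by linarith) (by linarith)]
      nlinarith
    calc |p y - p x| * |Real.log l| ≤ 2 * C₀ / |Real.log l| * |Real.log l| := by
          gcongr
          exact h1.trans h3
      _ = 2 * C₀ := div_mul_cancel₀ _ (by simpa using hlogneg.ne)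
      _ ≤ _ := by
        have := mul_nonneg hb0 hlogN.le
        linarith

theorem abs_one_div_sub_one_div_le {a s t : ℝ} (ha : 0 < a) (hs : a ≤ s) (ht : a ≤ t) :
    |1 / s - 1 / t| ≤ 1 / a ^ 2 * |s - t| := by
  have hs0 : 0 < s := ha.trans_le hs
  have ht0 : 0 < t := ha.trans_le ht
  have : 1 / s - 1 / t = -((1 / (s * t)) * (s - t)) := by
    field_simp
    ring
  rw [this, abs_neg, abs_mul, abs_of_pos (by positivity)]
  gcongr
  nlinarith

/-- Both integrands are bounded pointwise: the second is `l^{-n p(y)/p(x)}`, which differs from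
`l⁻ⁿ` by a factor of at most `exp(nC/a)`. -/
theorem cubeRegular_small {a C : ℝ} (ha : 0 < a) (hpa : ∀ x, a ≤ p x)
    {x : EuclideanSpace ℝ (Fin n)} {l : ℝ} (hl : 0 < l)
    (hC : ∀ y ∈ cube x l, |p y - p x| * |Real.log l| ≤ C) :
    (∫⁻ y in cube x l, ENNReal.ofReal (|1 / p y - 1 / p x| * |Real.log l|) ≤
      ENNReal.ofReal (1 / a ^ 2 * C * l ^ n)) ∧
    ∫⁻ y in cube x l, ENNReal.ofReal (Real.exp (-(n * (1 / p x) * p y * Real.log l))) ≤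
      ENNReal.ofReal (Real.exp (n / a * C)) := by
  have hx := hpa x
  have hx0 := ha.trans_le hx
  have hC0 : 0 ≤ C := le_trans (by positivity) (hC x (by intro i; simp; linarith))
  constructor
  · refine (setLIntegral_le_of_le_add_indicator (c := 1 / a ^ 2 * C) (d := 0)
      (measurableSet_cube _ _) MeasurableSet.empty (fun y hy _ => ?_) (by simp)).trans ?_
    · calc _ ≤ 1 / a ^ 2 * |p y - p x| * |Real.log l| := by
            gcongr
            exact abs_one_div_sub_one_div_le ha (hpa y) hx
        _ ≤ _ := by
            rw [mul_assoc]
            have := hC y hy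
            gcongr
    · rw [volume_cube x hl.le, ← ENNReal.ofReal_mul (by positivity)]
      simp
  · refine (setLIntegral_le_of_le_add_indicator
      (c := Real.exp (n / a * C) * (l ^ n)⁻¹) (d := 0)
      (measurableSet_cube _ _) MeasurableSet.empty (fun y hy _ => ?_) (by simp)).trans ?_
    · rw [← Real.exp_log (show 0 < (l ^ n)⁻¹ by positivity), ← Real.exp_add, Real.exp_le_exp,
        Real.log_inv, Real.log_pow]
      have h1 : -(n * (1 / p x) * p y * Real.log l) =
          n * (1 / p x) * (-((p y - p x) * Real.log l)) + -(n * Real.log l) := by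
        field_simp
        ring
      rw [h1]
      refine add_le_add ?_ le_rfl
      have h2 : -((p y - p x) * Real.log l) ≤ C := by
        refine le_trans (neg_le_abs _) ?_
        rw [abs_mul]
        exact hC y hy
      calc _ ≤ n * (1 / p x) * C := by gcongr
        _ ≤ n * (1 / a) * C := by gcongr
        _ = _ := by ring
    · rw [volume_cube x hl.le, ← ENNReal.ofReal_mul (by positivity),
        mul_assoc, inv_mul_cancel₀ (by positivity)]
      simp

/-- A large cube may contain points near the origin, where decay at infinity says nothing. With `θ =
a / r`, points of norm at least `l^{θ/2}` satisfy `|p - r| log l ≤ 2C/θ`. The remaining points lie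
in a cube of volume `2ⁿ l^{nθ/2}`, small enough to absorb the bounds obtained from `a ≤ p ≤ b`
alone. -/
theorem cubeRegular_large {a b r C : ℝ} (hn : 1 ≤ n) (ha : 0 < a) (hpa : ∀ x, a ≤ p x)
    (hpb : ∀ x, p x ≤ b) (har : a ≤ r) (hC : 0 < C)
    (h : ∀ x, |p x - r| ≤ C / Real.log (Real.exp 1 + ‖x‖)) :
    ∃ K, 0 < K ∧ ∀ x l, 1 < l →
    (∫⁻ y in cube x l, ENNReal.ofReal (|1 / p y - 1 / r| * |Real.log l|) ≤
      ENNReal.ofReal (K * l ^ n)) ∧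
    ∫⁻ y in cube x l, ENNReal.ofReal (Real.exp (-(n * (1 / r) * p y * Real.log l))) ≤
      ENNReal.ofReal K := by
  have hr0 : 0 < r := ha.trans_le har
  have hb0 : 0 < b := ha.trans_le ((hpa 0).trans (hpb 0))
  obtain ⟨θ, hθ⟩ : ∃ θ, θ = a / r := ⟨_, rfl⟩
  have hθ0 : 0 < θ := by rw [hθ]; positivity
  have hθ1 : θ ≤ 1 := by rw [hθ]; exact (div_le_one hr0).2 har
  have hn1 : (1 : ℝ) ≤ n := by exact_mod_cast hn
  have far : ∀ l, 1 < l → ∀ y, y ∉ cube (0 : EuclideanSpace ℝ (Fin n)) (2 * l ^ (θ / 2)) →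
      |p y - r| * Real.log l ≤ 2 * C / θ := by
    intro l hl y hy
    have hlog : 0 < Real.log l := Real.log_pos hl
    have h1 : l ^ (θ / 2) ≤ ‖y‖ := by
      by_contra! hcon
      exact hy (mem_cube_zero_of_norm_lt hcon)
    have h2 : θ / 2 * Real.log l ≤ Real.log (Real.exp 1 + ‖y‖) := by
      rw [← Real.log_rpow (by linarith)]
      refine Real.log_le_log (by positivity) ?_
      linarith [Real.exp_pos 1]
    calc |p y - r| * Real.log l ≤ C / (θ / 2 * Real.log l) * Real.log l := by
          gcongr
          exact (h y).trans (by gcongr)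
      _ = _ := by field_simp
  have volB : ∀ l, 1 < l → volume (cube (0 : EuclideanSpace ℝ (Fin n)) (2 * l ^ (θ / 2))) =
      ENNReal.ofReal (2 ^ n * l ^ (n * θ / 2)) := by
    intro l hl
    rw [volume_cube _ (by positivity), mul_pow, ← Real.rpow_natCast (l ^ (θ / 2)),
      ← Real.rpow_mul (by linarith)]
    congr 3
    ring
  refine ⟨1 / a ^ 2 * (2 * C / θ) + 1 / a ^ 2 * (b + r) * 2 * 2 ^ n +
    (Real.exp (n * (1 / r) * (2 * C / θ)) + 2 ^ n), by positivity, fun x l hl => ⟨?_, ?_⟩⟩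
  · have hl0 : 0 < l := by linarith
    have hlog : 0 < Real.log l := Real.log_pos hl
    have hdiff : ∀ y, |1 / p y - 1 / r| * |Real.log l| ≤ 1 / a ^ 2 * (|p y - r| * Real.log l) := by
      intro y
      rw [abs_of_pos hlog, ← mul_assoc]
      gcongr
      exact abs_one_div_sub_one_div_le ha (hpa y) har
    refine (setLIntegral_le_of_le_add_indicator (c := 1 / a ^ 2 * (2 * C / θ))
      (d := 1 / a ^ 2 * ((b + r) * Real.log l))
      (B := cube 0 (2 * l ^ (θ / 2)))
      (measurableSet_cube _ _) (measurableSet_cube _ _) (fun y hy hB => ?_)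
      (fun y hy hB => ?_)).trans ?_
    · refine (hdiff y).trans ?_
      gcongr
      exact far l hl y hB
    · refine (hdiff y).trans ?_
      gcongr
      rw [abs_le]
      constructor <;> linarith [hpa y, hpb y]
    · rw [volume_cube x hl0.le, volB l hl, ← ENNReal.ofReal_mul (by positivity),
        ← ENNReal.ofReal_mul (by positivity), ← ENNReal.ofReal_add (by positivity) (by positivity)]
      refine ENNReal.ofReal_le_ofReal ?_
      -- `log l ≤ 2 √l`, and `1/2 + nθ/2 ≤ n` since `θ ≤ 1 ≤ n`.
      have h1 : Real.log l * l ^ (n * θ / 2) ≤ 2 * l ^ n := by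
        calc Real.log l * l ^ (n * θ / 2)
            ≤ l ^ (1 / 2 : ℝ) / (1 / 2) * l ^ (n * θ / 2) := by
              gcongr
              exact Real.log_le_rpow_div hl0.le (by norm_num)
          _ = 2 * l ^ (1 / 2 + n * θ / 2 : ℝ) := by
              rw [Real.rpow_add hl0]; ring
          _ ≤ 2 * l ^ (n : ℝ) := by
              gcongr 2 * ?_
              refine Real.rpow_le_rpow_of_exponent_le hl.le ?_
              nlinarith
          _ = _ := by rw [Real.rpow_natCast]
      have h2 : 1 / a ^ 2 * ((b + r) * Real.log l) * (2 ^ n * l ^ (n * θ / 2)) ≤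
          1 / a ^ 2 * (b + r) * 2 ^ n * (2 * l ^ n) := by
        calc _ = 1 / a ^ 2 * (b + r) * 2 ^ n * (Real.log l * l ^ (n * θ / 2)) := by ring
          _ ≤ _ := by gcongr
      have h3 : 0 ≤ (Real.exp (n * (1 / r) * (2 * C / θ)) + 2 ^ n) * l ^ n := by positivity
      linarith
  · have hl0 : 0 < l := by linarith
    have hlog : 0 < Real.log l := Real.log_pos hl
    have hK : 0 ≤ 1 / a ^ 2 * (2 * C / θ) + 1 / a ^ 2 * (b + r) * 2 * 2 ^ n := by positivity
    refine (setLIntegral_le_of_le_add_indicator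
      (c := Real.exp (n * (1 / r) * (2 * C / θ)) * (l ^ n)⁻¹)
      (d := l ^ (-(n * θ)))
      (B := cube 0 (2 * l ^ (θ / 2)))
      (measurableSet_cube _ _) (measurableSet_cube _ _) (fun y hy hB => ?_)
      (fun y hy hB => ?_)).trans ?_
    · rw [← Real.exp_log (show 0 < (l ^ n)⁻¹ by positivity), ← Real.exp_add, Real.exp_le_exp,
        Real.log_inv, Real.log_pow]
      have h1 : -(n * (1 / r) * p y * Real.log l) =
          n * (1 / r) * (-((p y - r) * Real.log l)) + -(n * Real.log l) := by
        field_simp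
        ring
      rw [h1]
      gcongr
      refine le_trans (neg_le_abs _) ?_
      rw [abs_mul, abs_of_pos hlog]
      exact far l hl y hB
    · rw [Real.rpow_def_of_pos hl0, Real.exp_le_exp, hθ]
      have : n * (1 / r) * a * Real.log l ≤ n * (1 / r) * p y * Real.log l := by
        gcongr
        exact hpa y
      calc _ ≤ -(n * (1 / r) * a * Real.log l) := by linarith
        _ = _ := by ring
    · rw [volume_cube x hl0.le, volB l hl, ← ENNReal.ofReal_mul (by positivity),
        ← ENNReal.ofReal_mul (by positivity), ← ENNReal.ofReal_add (by positivity) (by positivity)]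
      refine ENNReal.ofReal_le_ofReal ?_
      have h1 : l ^ (-(n * θ)) * (2 ^ n * l ^ (n * θ / 2)) ≤ 2 ^ n := by
        calc l ^ (-(n * θ)) * (2 ^ n * l ^ (n * θ / 2)) = 2 ^ n * l ^ (-(n * θ) + n * θ / 2) := by
              rw [Real.rpow_add hl0]; ring
          _ ≤ 2 ^ n * 1 := by
              gcongr
              refine Real.rpow_le_one_of_one_le_of_nonpos hl.le ?_
              nlinarith
          _ = _ := by ring
      rw [mul_assoc, inv_mul_cancel₀ (by positivity), mul_one]
      linarith

theorem IsExponentP0.exists_cubeRegular (hn : 1 ≤ n) (hp : IsExponentP0 p) (hLH : IsLH p) :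
    ∃ b C q, CubeRegular p (essInf p volume) b C q := by
  obtain ⟨h0, r, C, hr, hC, hinf⟩ := hLH
  have hcont := h0.continuous
  obtain ⟨a, ha⟩ : ∃ a, a = essInf p volume := ⟨_, rfl⟩
  have hpa : ∀ x, a ≤ p x := fun x => ha ▸ hp.essInf_le hcont x
  have ha0 : 0 < a := ha ▸ hp.essInf_pos
  have hlog : ∀ x : EuclideanSpace ℝ (Fin n), 1 ≤ Real.log (Real.exp 1 + ‖x‖) := fun x => by
    rw [Real.le_log_iff_exp_le (by positivity)]
    linarith [norm_nonneg x]
  have hpb : ∀ x, p x ≤ r + C := fun x => by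
    have h1 := (hinf x).trans (div_le_self hC.le (hlog x))
    linarith [(abs_le.1 h1).2]
  -- Let `|x| → ∞` in `a ≤ p x`; `n ≥ 1` ensures that the space is unbounded.
  have har : a ≤ r := by
    have : NeZero n := ⟨by omega⟩
    have hnt : Nontrivial (EuclideanSpace ℝ (Fin n)) := inferInstance
    have h1 : Filter.Tendsto (fun x : EuclideanSpace ℝ (Fin n) => r + C / Real.log (Real.exp 1 + ‖x‖))
        (Bornology.cobounded _) (nhds (r + 0)) := by
      refine tendsto_const_nhds.add (Filter.Tendsto.const_div_atTop ?_ C)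
      exact Real.tendsto_log_atTop.comp
        (Filter.tendsto_atTop_add_const_left _ _ tendsto_norm_cobounded_atTop)
    rw [add_zero] at h1
    refine ge_of_tendsto h1 (Filter.Eventually.of_forall fun x => ?_)
    linarith [(abs_le.1 (hinf x)).2, hpa x]
  obtain ⟨C₁, hC₁, hsmall⟩ := h0.exists_osc_le (fun x => (hp.pos x).le) hpb
  obtain ⟨K, hK, hlarge⟩ := cubeRegular_large hn ha0 hpa hpb har hC hinf
  rw [← ha]
  have hA : 0 ≤ 1 / a ^ 2 * C₁ := by positivity
  have hB := Real.exp_pos (n / a * C₁)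
  refine ⟨r + C, 1 + 1 / a ^ 2 * C₁ + Real.exp (n / a * C₁) + K, localExponent p r,
    hp.measurable, ha0, hpa, hpb, by linarith, ?_, ?_, ?_, ?_, ?_⟩
  · intro x l
    unfold localExponent
    split_ifs
    · have := hpa x; gcongr
    · gcongr
  · intro x l s hl hs
    simp [localExponent, hl, hs]
  · intro x l s hl hs
    simp [localExponent, hl.not_ge, hs.not_ge]
  · intro x l hl
    rcases le_or_gt l 1 with h1 | h1
    · simp only [localExponent, h1, if_true]
      refine (cubeRegular_small ha0 hpa hl (hsmall x l hl h1)).1.trans ?_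
      refine ENNReal.ofReal_le_ofReal (mul_le_mul_of_nonneg_right (by linarith) (by positivity))
    · simp only [localExponent, h1.not_ge, if_false]
      refine (hlarge x l h1).1.trans ?_
      refine ENNReal.ofReal_le_ofReal (mul_le_mul_of_nonneg_right (by linarith) (by positivity))
  · intro x l hl
    rcases le_or_gt l 1 with h1 | h1
    · simp only [localExponent, h1, if_true]
      refine (cubeRegular_small ha0 hpa hl (hsmall x l hl h1)).2.trans ?_
      exact ENNReal.ofReal_le_ofReal (by linarith)
    · simp only [localExponent, h1.not_ge, if_false]
      refine (hlarge x l h1).2.trans ?_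
      exact ENNReal.ofReal_le_ofReal (by linarith)

end Exponent

/-! ### Geometric means with extended logarithms. -/

section GeomMean

variable {n : ℕ} {Q : Set (EuclideanSpace ℝ (Fin n))}

theorem geomMean_mono {f g : EuclideanSpace ℝ (Fin n) → ℝ≥0∞}
    (h : ∀ᵐ y ∂(volume.restrict Q), f y ≤ g y) : geomMean Q f ≤ geomMean Q g := by
  unfold geomMean
  rw [EReal.exp_le_exp_iff, EReal.neg_le_neg_iff]
  refine EReal.sub_le_sub ?_ ?_ <;> rw [EReal.coe_ennreal_le_coe_ennreal_iff] <;>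
    refine laverage_mono_ae (h.mono fun y hy => EReal.toENNReal_le_toENNReal ?_)
  · rw [EReal.neg_le_neg_iff]
    exact ENNReal.log_le_log_iff.2 hy
  · exact ENNReal.log_le_log_iff.2 hy

theorem log_ofReal_exp (t : ℝ) : ENNReal.log (ENNReal.ofReal (Real.exp t)) = (t : EReal) := by
  rw [← EReal.exp_coe, EReal.log_exp]

theorem geomMean_ofReal_exp {h : EuclideanSpace ℝ (Fin n) → ℝ} (hQ0 : volume Q ≠ 0)
    (hh : IntegrableOn h Q) :
    geomMean Q (fun y => ENNReal.ofReal (Real.exp (h y))) =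
      ENNReal.ofReal (Real.exp (⨍ y in Q, h y)) := by
  have hpos : ∫⁻ y in Q, ENNReal.ofReal (h y) ≠ ∞ :=
    ((lintegral_ofReal_le_lintegral_enorm h).trans_lt hh.2).ne
  have hneg : ∫⁻ y in Q, ENNReal.ofReal (-h y) ≠ ∞ := by
    refine ((lintegral_ofReal_le_lintegral_enorm _).trans_lt ?_).ne
    exact hh.neg.2
  unfold geomMean
  simp only [log_ofReal_exp, ← EReal.coe_neg, EReal.real_coe_toENNReal]
  rw [setAverage_eq, setLAverage_eq, setLAverage_eq,
    integral_eq_lintegral_pos_part_sub_lintegral_neg_part hh,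
    ← EReal.coe_ennreal_toReal (ENNReal.div_ne_top hneg hQ0),
    ← EReal.coe_ennreal_toReal (ENNReal.div_ne_top hpos hQ0), ← EReal.coe_sub, ← EReal.coe_neg,
    EReal.exp_coe, ENNReal.toReal_div, ENNReal.toReal_div]
  congr 2
  simp only [Measure.real, smul_eq_mul]
  ring

/-- In `EReal`, `c - ⊤ = ⊥` for every `c`, including `⊤`. So an infinite positive part makes the
geometric mean infinite whatever the negative part is. -/
theorem setLIntegral_log_ne_top_of_geomMean_lt_top {f : EuclideanSpace ℝ (Fin n) → ℝ≥0∞}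
    (hQ : volume Q ≠ ∞) (h : geomMean Q f < ∞) :
    ∫⁻ y in Q, (ENNReal.log (f y)).toENNReal ≠ ∞ := by
  intro hcon
  unfold geomMean at h
  rw [setLAverage_eq _ (fun y => (ENNReal.log (f y)).toENNReal), hcon,
    ENNReal.top_div_of_ne_top hQ] at h
  simp at h

theorem ae_lt_top_of_geomMean_lt_top {f : EuclideanSpace ℝ (Fin n) → ℝ≥0∞}
    (hQ : volume Q ≠ ∞) (hf : AEMeasurable f (volume.restrict Q)) (h : geomMean Q f < ∞) :
    ∀ᵐ y ∂(volume.restrict Q), f y < ∞ := by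
  have hm : AEMeasurable (fun y => (ENNReal.log (f y)).toENNReal) (volume.restrict Q) :=
    measurable_ereal_toENNReal.comp_aemeasurable (ENNReal.measurable_log.comp_aemeasurable hf)
  filter_upwards [ae_lt_top' hm (setLIntegral_log_ne_top_of_geomMean_lt_top hQ h)] with y hy
  by_contra hcon
  rw [not_lt, top_le_iff] at hcon
  simp [hcon] at hy

/-- Finiteness of the geometric mean controls the positive part of `log f`, and the integrable
minorant `g` controls the negative part. Afterwards ordinary Bochner averages can be used. -/
theorem exists_integrableOn_of_geomMean_lt_top {f : EuclideanSpace ℝ (Fin n) → ℝ≥0∞}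
    {g : EuclideanSpace ℝ (Fin n) → ℝ} (hQ : volume Q ≠ ∞)
    (hf : AEMeasurable f (volume.restrict Q)) (hg : IntegrableOn g Q)
    (hgf : ∀ᵐ y ∂(volume.restrict Q), ENNReal.ofReal (Real.exp (g y)) ≤ f y)
    (h : geomMean Q f < ∞) :
    ∃ h : EuclideanSpace ℝ (Fin n) → ℝ, IntegrableOn h Q ∧
      ∀ᵐ y ∂(volume.restrict Q), f y = ENNReal.ofReal (Real.exp (h y)) := by
  have hpos' := setLIntegral_log_ne_top_of_geomMean_lt_top hQ h
  have hm : AEMeasurable (fun y => ENNReal.log (f y)) (volume.restrict Q) :=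
    ENNReal.measurable_log.comp_aemeasurable hf
  have hfin := ae_lt_top_of_geomMean_lt_top hQ hf h
  have heq : ∀ᵐ y ∂(volume.restrict Q),
      ENNReal.log (f y) = ((ENNReal.log (f y)).toReal : EReal) := by
    filter_upwards [hfin, hgf] with y h1 h2
    refine (EReal.coe_toReal ?_ ?_).symm
    · intro hcon
      rw [ENNReal.log_eq_top_iff] at hcon
      exact h1.ne hcon
    · intro hcon
      have := ENNReal.log_le_log_iff.2 h2
      rw [hcon, log_ofReal_exp] at this
      simp at this
  refine ⟨fun y => (ENNReal.log (f y)).toReal, ⟨?_, ?_⟩, ?_⟩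
  · exact (measurable_ereal_toReal.comp_aemeasurable hm).aestronglyMeasurable
  · rw [hasFiniteIntegral_iff_enorm]
    have h1 : ∀ᵐ y ∂(volume.restrict Q), ‖(ENNReal.log (f y)).toReal‖ₑ ≤
        (ENNReal.log (f y)).toENNReal + ‖g y‖ₑ := by
      filter_upwards [heq, hgf] with y h1 h2
      have h3 := ENNReal.log_le_log_iff.2 h2
      rw [h1, log_ofReal_exp, EReal.coe_le_coe_iff] at h3
      conv_rhs => rw [h1]
      rw [EReal.real_coe_toENNReal, Real.enorm_eq_ofReal_abs, Real.enorm_eq_ofReal_abs]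
      rcases le_total 0 (ENNReal.log (f y)).toReal with h4 | h4
      · rw [abs_of_nonneg h4]
        exact le_self_add
      · refine le_trans (ENNReal.ofReal_le_ofReal ?_) le_add_self
        rw [abs_of_nonpos h4]
        exact le_trans (by linarith) (neg_le_abs _)
    refine (lintegral_mono_ae h1).trans_lt ?_
    have h2 : AEMeasurable (fun y => (ENNReal.log (f y)).toENNReal) (volume.restrict Q) :=
      measurable_ereal_toENNReal.comp_aemeasurable hm
    rw [lintegral_add_left' h2]
    exact ENNReal.add_lt_top.2 ⟨hpos'.lt_top, hg.2⟩
  · filter_upwards [heq] with y h1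
    rw [← EReal.exp_coe, ← h1, ENNReal.exp_log]

end GeomMean

/-! ### Jensen's inequality and norms of indicators of cubes. -/

section Jensen

variable {n : ℕ} {p : EuclideanSpace ℝ (Fin n) → ℝ} {a b C : ℝ}
  {q : EuclideanSpace ℝ (Fin n) → ℝ → ℝ}

theorem integrable_and_integral_le_of_lintegral_le {α : Type*} [MeasurableSpace α] {μ : Measure α}
    {f : α → ℝ} {c : ℝ} (hc : 0 ≤ c) (hf : AEMeasurable f μ) (h0 : ∀ᵐ y ∂μ, 0 ≤ f y)
    (h : ∫⁻ y, ENNReal.ofReal (f y) ∂μ ≤ ENNReal.ofReal c) :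
    Integrable f μ ∧ ∫ y, f y ∂μ ≤ c := by
  refine ⟨⟨hf.aestronglyMeasurable, ?_⟩, ?_⟩
  · rw [hasFiniteIntegral_iff_ofReal h0]
    exact h.trans_lt ENNReal.ofReal_lt_top
  · rw [integral_eq_lintegral_of_nonneg_ae h0 hf.aestronglyMeasurable]
    exact ENNReal.toReal_le_of_le_ofReal hc h

theorem CubeRegular.pos (h : CubeRegular p a b C q) (x : EuclideanSpace ℝ (Fin n)) : 0 < p x :=
  h.lower_pos.trans_le (h.lower_le x)

theorem rpow_integrable_and_integral_le {E : Set (EuclideanSpace ℝ (Fin n))}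
    (hpm : Measurable p)
    {u : EuclideanSpace ℝ (Fin n) → ℝ} (hum : AEMeasurable u) (hu : ∀ᵐ y, 0 < u y)
    {s : ℝ} (hs : 0 < s) (h : ∫⁻ y in E, ‖u y / s‖ₑ ^ p y ≤ 1) :
    IntegrableOn (fun y => (u y / s) ^ p y) E ∧ ∫ y in E, (u y / s) ^ p y ≤ 1 := by
  refine integrable_and_integral_le_of_lintegral_le zero_le_one
    ((hum.div_const s).pow hpm.aemeasurable).restrict ?_ ?_
  · exact ae_restrict_of_ae (hu.mono fun y hy => by positivity)
  · rw [ENNReal.ofReal_one]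
    refine le_trans (lintegral_mono_ae (ae_restrict_of_ae (hu.mono fun y hy => ?_))) h
    rw [Real.enorm_eq_ofReal (by positivity), ENNReal.ofReal_rpow_of_pos (by positivity)]

/-- Jensen's inequality for the variable exponent modular. -/
theorem CubeRegular.setIntegral_log_le (hR : CubeRegular p a b C q)
    {x : EuclideanSpace ℝ (Fin n)} {l : ℝ} (hl : 0 < l) {E : Set (EuclideanSpace ℝ (Fin n))}
    (hEQ : E ⊆ cube x l)
    {u : EuclideanSpace ℝ (Fin n) → ℝ} (hum : AEMeasurable u) (hu : ∀ᵐ y, 0 < u y)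
    (hlog : IntegrableOn (fun y => Real.log (u y)) E) {s : ℝ} (hs : 0 < s)
    (h : ∫⁻ y in E, ‖u y / s‖ₑ ^ p y ≤ 1) :
    ∫ y in E, Real.log (u y) ≤
      (1 / a + n * C) * l ^ n + volume.real E * (Real.log s - n * q x l * Real.log l) := by
  have ha := hR.lower_pos
  have hC := hR.one_le_const
  have hE' : volume E ≠ ∞ := ne_top_of_le_ne_top (volume_cube_ne_top x hl.le) (measure_mono hEQ)
  obtain ⟨hi1, hi2⟩ := rpow_integrable_and_integral_le hR.measurable hum hu hs h
  obtain ⟨ho1, ho2⟩ := integrable_and_integral_le_of_lintegral_le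
    (μ := volume.restrict E) (f := fun y => |1 / p y - q x l| * |Real.log l|) (c := C * l ^ n)
    (by positivity) (by have := hR.measurable; fun_prop)
    (Filter.Eventually.of_forall fun y => by positivity)
    ((lintegral_mono_set hEQ).trans (hR.oscillation x l hl))
  have hc : IntegrableOn (fun _ => Real.log s - n * q x l * Real.log l) E volume :=
    integrableOn_const hE'
  calc ∫ y in E, Real.log (u y)
      ≤ ∫ y in E, ((Real.log s - n * q x l * Real.log l) +
          n * (|1 / p y - q x l| * |Real.log l|) + 1 / a * l ^ n * (u y / s) ^ p y) := by
        refine integral_mono_ae hlog ((hc.add (ho1.const_mul _)).add (hi1.const_mul _)) ?_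
        refine ae_restrict_of_ae (hu.mono fun y hy => ?_)
        have hpy := hR.pos y
        -- This is `z + 1 ≤ exp z` at `z = log ((u/s)^p lⁿ)`. The factor `lⁿ = |Q|` makes the error
        -- proportional to `|Q|` after integration.
        have h1 : p y * Real.log (u y / s) + n * Real.log l ≤ (u y / s) ^ p y * l ^ n := by
          have h2 : (u y / s) ^ p y * l ^ n =
              Real.exp (p y * Real.log (u y / s) + n * Real.log l) := by
            rw [Real.exp_add, Real.rpow_def_of_pos (by positivity), ← Real.log_pow,
              Real.exp_log (by positivity)]
            ring_nf
          rw [h2]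
          have := Real.add_one_le_exp (p y * Real.log (u y / s) + n * Real.log l)
          linarith
        have h3 : Real.log (u y / s) ≤
            1 / a * ((u y / s) ^ p y * l ^ n) - 1 / p y * (n * Real.log l) := by
          have h4 : 1 / p y * (p y * Real.log (u y / s) + n * Real.log l) ≤
              1 / a * ((u y / s) ^ p y * l ^ n) := by
            have := hR.lower_le y
            calc _ ≤ 1 / p y * ((u y / s) ^ p y * l ^ n) := by gcongr
              _ ≤ _ := by gcongr
          have h5 : 1 / p y * (p y * Real.log (u y / s)) = Real.log (u y / s) := by
            field_simp
          linarith
        rw [Real.log_div hy.ne' hs.ne'] at h3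
        -- The pointwise `1 / p y` is exchanged for the constant `q x l`; the `oscillation` bound
        -- pays for it on average.
        have h6 : -((1 / p y - q x l) * Real.log l) ≤ |1 / p y - q x l| * |Real.log l| := by
          rw [← abs_mul]; exact neg_le_abs _
        have h7 := mul_le_mul_of_nonneg_left h6 (Nat.cast_nonneg n (α := ℝ))
        simp only
        linarith
    _ = volume.real E * (Real.log s - n * q x l * Real.log l) +
          n * (∫ y in E, |1 / p y - q x l| * |Real.log l|) +
          1 / a * l ^ n * ∫ y in E, (u y / s) ^ p y := by
        have h1 : Integrable (fun y => Real.log s - n * q x l * Real.log l +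
            n * (|1 / p y - q x l| * |Real.log l|)) (volume.restrict E) :=
          hc.add (ho1.const_mul _)
        rw [integral_add h1 (hi1.const_mul _), integral_add hc (ho1.const_mul _), integral_const_mul, integral_const_mul,
          setIntegral_const, smul_eq_mul]
    _ ≤ volume.real E * (Real.log s - n * q x l * Real.log l) + n * (C * l ^ n) +
          1 / a * l ^ n * 1 := by gcongr
    _ = _ := by ring

/-- Jensen's inequality divided by `|E|`, for each admissible `s`. The density `κ` converts the
error from a multiple of `|Q|` to a multiple of `|E|`. -/
theorem CubeRegular.exp_setAverage_log_le_varNorm (hR : CubeRegular p a b C q)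
    {x : EuclideanSpace ℝ (Fin n)} {l κ : ℝ} (hl : 0 < l) (hκ : 0 < κ)
    {E : Set (EuclideanSpace ℝ (Fin n))}
    (hE : MeasurableSet E) (hEQ : E ⊆ cube x l) (hEκ : κ * l ^ n ≤ volume.real E)
    {u : EuclideanSpace ℝ (Fin n) → ℝ} (hum : AEMeasurable u) (hu : ∀ᵐ y, 0 < u y)
    (hlog : IntegrableOn (fun y => Real.log (u y)) E) :
    ENNReal.ofReal (Real.exp ((⨍ y in E, Real.log (u y)) + n * q x l * Real.log l -
      (1 / a + n * C) / κ)) ≤ varNorm p (E.indicator u) := by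
  have ha := hR.lower_pos
  have hC := hR.one_le_const
  refine le_varNorm fun s hs hm => ?_
  rw [modular_indicator hR.pos hE] at hm
  have h1 := hR.setIntegral_log_le hl hEQ hum hu hlog hs hm
  have hE0 : 0 < volume.real E := lt_of_lt_of_le (by positivity) hEκ
  rw [← Real.le_log_iff_exp_le hs, setAverage_eq, smul_eq_mul]
  have h2 : l ^ n ≤ volume.real E / κ := by
    rw [le_div_iff₀ hκ, mul_comm]; exact hEκ
  have h3 : (1 / a + n * C) * l ^ n ≤ (1 / a + n * C) * (volume.real E / κ) := by gcongr
  have h4 : (volume.real E)⁻¹ * ∫ y in E, Real.log (u y) ≤ (volume.real E)⁻¹ *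
      ((1 / a + n * C) * (volume.real E / κ) +
        volume.real E * (Real.log s - n * q x l * Real.log l)) := by
    gcongr
    linarith
  have h5 : (volume.real E)⁻¹ * ((1 / a + n * C) * (volume.real E / κ) +
      volume.real E * (Real.log s - n * q x l * Real.log l)) =
      (1 / a + n * C) / κ + (Real.log s - n * q x l * Real.log l) := by
    field_simp
  linarith

theorem CubeRegular.varNorm_one_le (hR : CubeRegular p a b C q)
    (x : EuclideanSpace ℝ (Fin n)) {l : ℝ} (hl : 0 < l) :
    varNorm p ((cube x l).indicator fun _ => 1) ≤
      ENNReal.ofReal (Real.exp (n * q x l * Real.log l + Real.log C / a)) := by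
  have hC := hR.one_le_const
  have h1 : modular p (fun y => (cube x l).indicator (fun _ => (1 : ℝ)) y /
      Real.exp (n * q x l * Real.log l)) ≤ ENNReal.ofReal C := by
    rw [modular_indicator hR.pos (measurableSet_cube x l)]
    refine le_trans (le_of_eq (lintegral_congr fun y => ?_)) (hR.modular_le x l hl)
    rw [Real.enorm_eq_ofReal (by positivity), one_div, ← Real.exp_neg,
      ENNReal.ofReal_rpow_of_pos (Real.exp_pos _), ← Real.exp_mul]
    ring_nf
  refine (varNorm_le_of_modular_le hR.lower_pos hR.lower_le (Real.exp_pos _) hC h1).trans ?_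
  refine ENNReal.ofReal_le_ofReal (le_of_eq ?_)
  rw [Real.exp_add, Real.rpow_def_of_pos (by linarith)]
  ring_nf

/-- Jensen's inequality for `u = 1`. -/
theorem CubeRegular.le_varNorm_one (hR : CubeRegular p a b C q)
    (x : EuclideanSpace ℝ (Fin n)) {l : ℝ} (hl : 0 < l) :
    ENNReal.ofReal (Real.exp (n * q x l * Real.log l - (1 / a + n * C))) ≤
      varNorm p ((cube x l).indicator fun _ => 1) := by
  have := hR.exp_setAverage_log_le_varNorm hl one_pos (measurableSet_cube x l) subset_rfl
    (by rw [volume_real_cube x hl.le, one_mul]) (u := fun _ => 1) aemeasurable_const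
    (Filter.Eventually.of_forall fun _ => one_pos) (by simp)
  simpa using this

theorem CubeRegular.varNorm_one_dilate_le (hR : CubeRegular p a b C q)
    (x : EuclideanSpace ℝ (Fin n)) {l t : ℝ} (hl : 0 < l) (ht : 1 ≤ t) :
    varNorm p ((cube x (t * l)).indicator fun _ => 1) ≤
      ENNReal.ofReal (Real.exp (Real.log C / a + (1 / a + n * C)) * t ^ (n / a)) *
        varNorm p ((cube x l).indicator fun _ => 1) := by
  have ha := hR.lower_pos
  have ht0 : 0 < t := by linarith
  refine (hR.varNorm_one_le x (by positivity)).trans ?_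
  refine le_trans ?_ (mul_le_mul_right (hR.le_varNorm_one x hl) _)
  rw [← ENNReal.ofReal_mul (by positivity), Real.rpow_def_of_pos ht0, ← Real.exp_add,
    ← Real.exp_add]
  refine ENNReal.ofReal_le_ofReal (Real.exp_le_exp.2 ?_)
  have hlt : Real.log (t * l) = Real.log t + Real.log l := Real.log_mul ht0.ne' hl.ne'
  have hlogt : 0 ≤ Real.log t := Real.log_nonneg ht
  -- The local exponent is constant on each side of edge length `1`. If the dilation crosses `1`,
  -- the two logarithms have opposite signs, and `q ≤ 1 / a` can be applied to both terms.
  have key : q x (t * l) * Real.log (t * l) ≤ 1 / a * Real.log t + q x l * Real.log l := by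
    have hq := hR.q_le x l
    rcases le_or_gt (t * l) 1 with h1 | h1
    · rw [hR.q_small x (t * l) l h1 (le_trans (by nlinarith) h1), hlt]
      nlinarith
    · rcases le_or_gt l 1 with h2 | h2
      · have hq' := hR.q_le x (t * l)
        have h3 : 0 ≤ Real.log (t * l) := Real.log_nonneg h1.le
        have h4 : Real.log l ≤ 0 := Real.log_nonpos hl.le h2
        have h5 := mul_le_mul_of_nonneg_right hq' h3
        have h6 := mul_le_mul_of_nonpos_right hq h4
        rw [hlt] at h5 ⊢
        linarith
      · rw [hR.q_large x (t * l) l h1 h2, hlt]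
        nlinarith
  have h5 := mul_le_mul_of_nonneg_left key (Nat.cast_nonneg n (α := ℝ))
  have h6 : Real.log t * (n / a) = n * (1 / a * Real.log t) := by ring
  rw [h6]
  linarith

end Jensen

/-! ### Doubling, reverse doubling and dimensions of scalar weights. -/

section Scalar

variable {n : ℕ} {p : EuclideanSpace ℝ (Fin n) → ℝ} {a b C A : ℝ}
  {q : EuclideanSpace ℝ (Fin n) → ℝ → ℝ} {w : EuclideanSpace ℝ (Fin n) → ℝ}

/-- Scalar `𝒜_{p(·),∞}` weights with constant at most `exp A`. -/
structure IsScalarApInfty (p : EuclideanSpace ℝ (Fin n) → ℝ) (A : ℝ)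
    (w : EuclideanSpace ℝ (Fin n) → ℝ) : Prop where
  aemeasurable : AEMeasurable w
  pos : ∀ᵐ y, 0 < w y
  integrableOn_log : ∀ x l, 0 < l → IntegrableOn (fun y => Real.log (w y)) (cube x l)
  varNorm_le : ∀ x l, 0 < l → varNorm p ((cube x l).indicator w) ≤
    ENNReal.ofReal (Real.exp (A + ⨍ y in cube x l, Real.log (w y))) *
      varNorm p ((cube x l).indicator fun _ => 1)

theorem CubeRegular.varNorm_one_pos (hR : CubeRegular p a b C q)
    (x : EuclideanSpace ℝ (Fin n)) {l : ℝ} (hl : 0 < l) :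
    varNorm p ((cube x l).indicator fun _ => 1) ≠ 0 :=
  ((ENNReal.ofReal_pos.2 (Real.exp_pos _)).trans_le (hR.le_varNorm_one x hl)).ne'

theorem CubeRegular.varNorm_one_ne_top (hR : CubeRegular p a b C q)
    (x : EuclideanSpace ℝ (Fin n)) {l : ℝ} (hl : 0 < l) :
    varNorm p ((cube x l).indicator fun _ => 1) ≠ ∞ :=
  ((hR.varNorm_one_le x hl).trans_lt ENNReal.ofReal_lt_top).ne

theorem IsScalarApInfty.exists_varNorm_eq (hw : IsScalarApInfty p A w)
    (hR : CubeRegular p a b C q) (x : EuclideanSpace ℝ (Fin n)) {l : ℝ} (hl : 0 < l) :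
    ∃ β : ℝ, varNorm p ((cube x l).indicator w) = ENNReal.ofReal (Real.exp β) := by
  have h1 : varNorm p ((cube x l).indicator w) ≠ ∞ :=
    ((hw.varNorm_le x l hl).trans_lt (ENNReal.mul_lt_top ENNReal.ofReal_lt_top
      (hR.varNorm_one_ne_top x hl).lt_top)).ne
  have h2 := hR.exp_setAverage_log_le_varNorm hl one_pos (measurableSet_cube x l) subset_rfl
    (by rw [volume_real_cube x hl.le, one_mul]) hw.aemeasurable hw.pos (hw.integrableOn_log x l hl)
  have h3 : varNorm p ((cube x l).indicator w) ≠ 0 :=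
    ((ENNReal.ofReal_pos.2 (Real.exp_pos _)).trans_le h2).ne'
  refine ⟨Real.log (varNorm p ((cube x l).indicator w)).toReal, ?_⟩
  rw [Real.exp_log (ENNReal.toReal_pos h3 h1), ENNReal.ofReal_toReal h1]

/-- The mean of `log w` over `5Q` is a convex combination of its means over the subcube and over the
complement. The weight condition bounds the full mean below in terms of `‖w 𝟏_{5Q}‖`, and Jensen
bounds the complement's mean above by the same norm. Hence the subcube's mean cannot be too small,
and Jensen there bounds its norm below. -/
theorem IsScalarApInfty.exists_doubling (hn : 1 ≤ n) (hR : CubeRegular p a b C q) (hA : 0 ≤ A) :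
    ∃ D : ℝ, 0 ≤ D ∧ ∀ w, IsScalarApInfty p A w → ∀ x y l, 0 < l → cube y l ⊆ cube x (5 * l) →
      varNorm p ((cube x (5 * l)).indicator w) ≤
        ENNReal.ofReal (Real.exp D) * varNorm p ((cube y l).indicator w) := by
  have ha := hR.lower_pos
  have hC := hR.one_le_const
  have h5 : (5 : ℝ) ≤ 5 ^ n := le_self_pow₀ (by norm_num) (by omega)
  have h50 : (0 : ℝ) < 5 ^ n := by positivity
  have hlogC : 0 ≤ Real.log C := Real.log_nonneg hC
  refine ⟨5 ^ n * (A + Real.log C / a + (1 / a + n * C) / (1 / 5 ^ n)), by positivity,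
    fun w hw x y l hl hsub => ?_⟩
  obtain ⟨T, hT⟩ : ∃ T, T = n * q x (5 * l) * Real.log (5 * l) := ⟨_, rfl⟩
  obtain ⟨K, hK⟩ : ∃ K, K = (1 / a + n * C) / (1 / 5 ^ n) := ⟨_, rfl⟩
  have hl5 : 0 < 5 * l := by linarith
  obtain ⟨α, hα⟩ := hw.exists_varNorm_eq hR x hl5
  obtain ⟨β, hβ⟩ := hw.exists_varNorm_eq hR y hl
  have hln : 0 < l ^ n := by positivity
  have hi := hw.integrableOn_log x (5 * l) hl5
  have hvR : volume.real (cube x (5 * l)) = 5 ^ n * l ^ n := by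
    rw [volume_real_cube x hl5.le, mul_pow]
  have hvQ : volume.real (cube y l) = l ^ n := volume_real_cube y hl.le
  have hvD : volume.real (cube x (5 * l) \ cube y l) = (5 ^ n - 1) * l ^ n := by
    rw [measureReal_sdiff hsub (measurableSet_cube y l)
      (volume_cube_ne_top x hl5.le), hvR, hvQ]
    ring
  -- Both pieces are measured against the large cube, so that the same `q x (5 * l)` occurs
  -- throughout. Each fills at least the fraction `5⁻ⁿ`; for the complement this uses `5ⁿ - 1 ≥ 1`.
  have h1 := hR.exp_setAverage_log_le_varNorm hl5 (κ := 1 / 5 ^ n) (by positivity)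
    (measurableSet_cube y l) hsub (by rw [hvQ, mul_pow]; field_simp; rfl) hw.aemeasurable hw.pos
    (hi.mono_set hsub)
  have h2 := hR.exp_setAverage_log_le_varNorm hl5 (κ := 1 / 5 ^ n) (by positivity)
    ((measurableSet_cube x (5 * l)).diff (measurableSet_cube y l)) Set.sdiff_subset
    (by rw [hvD, mul_pow]; field_simp; linarith) hw.aemeasurable hw.pos
    (hi.mono_set Set.sdiff_subset)
  replace h2 := h2.trans (varNorm_indicator_mono hR.pos Set.sdiff_subset)
  have h3 := (hw.varNorm_le x (5 * l) hl5).trans (mul_le_mul_right (hR.varNorm_one_le x hl5) _)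
  rw [hβ, ENNReal.ofReal_le_ofReal_iff (Real.exp_pos _).le, Real.exp_le_exp, ← hT, ← hK] at h1
  rw [hα, ENNReal.ofReal_le_ofReal_iff (Real.exp_pos _).le, Real.exp_le_exp, ← hT, ← hK] at h2
  rw [hα, ← ENNReal.ofReal_mul (Real.exp_pos _).le, ← Real.exp_add,
    ENNReal.ofReal_le_ofReal_iff (Real.exp_pos _).le, Real.exp_le_exp, ← hT] at h3
  have h4 : 5 ^ n * (⨍ z in cube x (5 * l), Real.log (w z)) =
      (⨍ z in cube y l, Real.log (w z)) +
        (5 ^ n - 1) * ⨍ z in cube x (5 * l) \ cube y l, Real.log (w z) := by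
    rw [setAverage_eq, setAverage_eq, setAverage_eq, hvR, hvQ, hvD,
      setIntegral_sdiff (measurableSet_cube y l) hi hsub]
    simp only [smul_eq_mul]
    have : (5 : ℝ) ^ n - 1 ≠ 0 := by linarith
    field_simp
    ring
  rw [hα, hβ, ← ENNReal.ofReal_mul (Real.exp_pos _).le, ← Real.exp_add, ← hK]
  refine ENNReal.ofReal_le_ofReal (Real.exp_le_exp.2 ?_)
  have h6 := mul_le_mul_of_nonneg_left h3 h50.le
  have h7 := mul_le_mul_of_nonneg_left h2 (show (0 : ℝ) ≤ 5 ^ n - 1 by linarith)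
  linarith

/-- By doubling, a disjoint translate of `Q` inside `5Q` has norm comparable to that of `5Q`, so it
takes at least `c ^ b` of a modular whose total is at most `1`. Only `1 - c ^ b` is left for `Q`,
and the upper bound `b` on the exponent turns this into a norm gain. -/
theorem IsScalarApInfty.exists_reverse_doubling (hn : 1 ≤ n) (hR : CubeRegular p a b C q)
    (hA : 0 ≤ A) :
    ∃ e : ℝ, 0 < e ∧ ∀ w, IsScalarApInfty p A w → ∀ x l, 0 < l →
      varNorm p ((cube x l).indicator w) ≤
        ENNReal.ofReal (Real.exp (-e)) * varNorm p ((cube x (5 * l)).indicator w) := by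
  obtain ⟨D, hD, hdoub⟩ := IsScalarApInfty.exists_doubling hn hR hA
  have ha := hR.lower_pos
  have hb : 0 < b := ha.trans_le ((hR.lower_le 0).trans (hR.le_upper 0))
  -- The factor `1 / 2` compensates for a scale `s` that may reach almost twice the norm over `5Q`.
  obtain ⟨c, hc⟩ : ∃ c, c = Real.exp (-D) / 2 := ⟨_, rfl⟩
  have hc0 : 0 < c := by rw [hc]; positivity
  have hc1 : c < 1 := by
    have : Real.exp (-D) ≤ 1 := Real.exp_le_one_iff.2 (by linarith)
    linarith
  have hcb : c ^ b < 1 := Real.rpow_lt_one hc0.le hc1 hb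
  have hcb0 : 0 < c ^ b := by positivity
  have hρ0 : 0 < 1 - c ^ b := by linarith
  have hρ : 0 < (1 - c ^ b) ^ (1 / b) := by positivity
  have hρ1 : (1 - c ^ b) ^ (1 / b) < 1 := Real.rpow_lt_one hρ0.le (by linarith) (by positivity)
  refine ⟨-Real.log ((1 - c ^ b) ^ (1 / b)), neg_pos.2 (Real.log_neg hρ hρ1), ?_⟩
  intro w hw x l hl
  rw [neg_neg, Real.exp_log hρ]
  obtain ⟨ν, hν⟩ := hw.exists_varNorm_eq hR x (show 0 < 5 * l by linarith)
  obtain ⟨β, hβ⟩ := hw.exists_varNorm_eq hR x hl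
  rw [hν, hβ, ← ENNReal.ofReal_mul hρ.le]
  refine ENNReal.ofReal_le_ofReal ?_
  by_contra! hcon
  have hν0 := Real.exp_pos ν
  -- Exceeding the norm over `5Q` makes the modular at most `1`; staying below twice that norm keeps
  -- the neighbour's share; staying below the last quantity contradicts the resulting bound for `Q`.
  obtain ⟨s, hs1, hs2⟩ := exists_between (show Real.exp ν < min (2 * Real.exp ν)
    (Real.exp β / (1 - c ^ b) ^ (1 / b)) from lt_min (by linarith) (by
      rw [lt_div_iff₀ hρ]; linarith))
  have hs0 : 0 < s := hν0.trans hs1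
  have hs3 := hs2.trans_le (min_le_left _ _)
  have hs4 := hs2.trans_le (min_le_right _ _)
  -- A shift by `2l` leaves a gap between the closed cubes, and `2l + l/2 = 5l/2` just fits into
  -- `5Q`. This is why the dilation factor is `5`.
  obtain ⟨y, hy⟩ : ∃ y : EuclideanSpace ℝ (Fin n),
      y = x + EuclideanSpace.single (⟨0, by omega⟩ : Fin n) (2 * l) := ⟨_, rfl⟩
  have hsub : cube y l ⊆ cube x (5 * l) := by
    refine cube_subset_cube fun i => ?_
    rw [hy]
    by_cases hi : i = ⟨0, by omega⟩
    · simp [hi, abs_of_pos hl]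
      linarith
    · simp [hi]
      linarith
  have hsub' : cube x l ⊆ cube x (5 * l) := cube_mono x (by linarith)
  have hdisj : Disjoint (cube x l) (cube y l) := by
    rw [Set.disjoint_left]
    intro z hz1 hz2
    have h1 := abs_le.1 (hz1 ⟨0, by omega⟩)
    have h2 := abs_le.1 (hz2 ⟨0, by omega⟩)
    rw [hy] at h2
    simp at h2
    linarith [h1.1, h1.2, h2.1, h2.2]
  have hR1 : modular p (fun z => (cube x (5 * l)).indicator w z / s) ≤ 1 := by
    refine modular_le_one_of_lt hR.pos ?_
    rw [hν]
    exact (ENNReal.ofReal_lt_ofReal_iff hs0).2 hs1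
  have hQ' : ENNReal.ofReal (c ^ b) ≤ modular p (fun z => (cube y l).indicator w z / s) := by
    refine le_modular_of_lt_varNorm hR.pos hR.le_upper hs0 hc0 hc1.le ?_
    have h1 := hdoub w hw x y l hl hsub
    obtain ⟨γ, hγ⟩ := hw.exists_varNorm_eq hR y hl
    rw [hν, hγ, ← ENNReal.ofReal_mul (Real.exp_pos _).le,
      ENNReal.ofReal_le_ofReal_iff (by positivity)] at h1
    rw [hγ, ENNReal.ofReal_lt_ofReal_iff (Real.exp_pos _), hc]
    calc Real.exp (-D) / 2 * s < Real.exp (-D) / 2 * (2 * Real.exp ν) := by gcongr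
      _ = Real.exp (-D) * Real.exp ν := by ring
      _ ≤ Real.exp (-D) * (Real.exp D * Real.exp γ) := by gcongr
      _ = Real.exp γ := by rw [← mul_assoc, ← Real.exp_add]; simp
  have hsum : modular p (fun z => (cube x l).indicator w z / s) +
      modular p (fun z => (cube y l).indicator w z / s) ≤ 1 := by
    refine le_trans ?_ hR1
    rw [modular_indicator hR.pos (measurableSet_cube _ _),
      modular_indicator hR.pos (measurableSet_cube _ _),
      modular_indicator hR.pos (measurableSet_cube _ _),
      ← lintegral_union (measurableSet_cube y l) hdisj]
    exact lintegral_mono_set (Set.union_subset hsub' hsub)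
  have hQ : modular p (fun z => (cube x l).indicator w z / s) ≤ ENNReal.ofReal (1 - c ^ b) := by
    rw [ENNReal.ofReal_sub _ hcb0.le, ENNReal.ofReal_one]
    exact ENNReal.le_sub_of_add_le_right ENNReal.ofReal_ne_top
      ((add_le_add_right hQ' _).trans hsum)
  have hfin := varNorm_le_of_modular_le' hR.pos hb hR.le_upper hs0 hρ0 (by linarith) hQ
  rw [hβ, ENNReal.ofReal_le_ofReal_iff (by positivity)] at hfin
  rw [lt_div_iff₀ hρ] at hs4
  linarith

theorem IsScalarApInfty.exists_upper (hn : 1 ≤ n) (hR : CubeRegular p a b C q) (hA : 0 ≤ A) :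
    ∃ K d : ℝ, 0 ≤ d ∧ ∀ w, IsScalarApInfty p A w → ∀ x l t, 0 < l → 1 ≤ t →
      varNorm p ((cube x (t * l)).indicator w) /
          varNorm p ((cube x (t * l)).indicator fun _ => 1) ≤
        ENNReal.ofReal (Real.exp K * t ^ d) * (varNorm p ((cube x l).indicator w) /
          varNorm p ((cube x l).indicator fun _ => 1)) := by
  obtain ⟨D, hD, hdoub⟩ := IsScalarApInfty.exists_doubling hn hR hA
  have hlog5 : 0 < Real.log 5 := Real.log_pos (by norm_num)
  refine ⟨D, D / Real.log 5, by positivity, fun w hw x l t hl ht => ?_⟩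
  have ht0 : 0 < t := by linarith
  have hlogt : 0 ≤ Real.log t := Real.log_nonneg ht
  have iter : ∀ k : ℕ, varNorm p ((cube x (5 ^ k * l)).indicator w) ≤
      ENNReal.ofReal (Real.exp (k * D)) * varNorm p ((cube x l).indicator w) := by
    intro k
    induction k with
    | zero => simp
    | succ k ih =>
      have h1 := hdoub w hw x x (5 ^ k * l) (by positivity)
        (cube_mono x (by nlinarith [show 0 < 5 ^ k * l by positivity]))
      rw [← mul_assoc, ← pow_succ'] at h1
      refine h1.trans ((mul_le_mul_right ih _).trans (le_of_eq ?_))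
      rw [← mul_assoc, ← ENNReal.ofReal_mul (Real.exp_pos _).le, ← Real.exp_add]
      congr 3
      push_cast
      ring
  have hk1 : t ≤ 5 ^ ⌈Real.log t / Real.log 5⌉₊ := by
    rw [← Real.log_le_log_iff ht0 (by positivity), Real.log_pow, ← div_le_iff₀ hlog5]
    exact Nat.le_ceil _
  have hk2 := (Nat.ceil_lt_add_one (show 0 ≤ Real.log t / Real.log 5 by positivity)).le
  have h1 : varNorm p ((cube x (t * l)).indicator w) ≤
      ENNReal.ofReal (Real.exp D * t ^ (D / Real.log 5)) * varNorm p ((cube x l).indicator w) := by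
    refine (varNorm_indicator_mono hR.pos (cube_mono x ?_)).trans
      ((iter ⌈Real.log t / Real.log 5⌉₊).trans (mul_le_mul_left (ENNReal.ofReal_le_ofReal ?_) _))
    · gcongr
    · rw [Real.rpow_def_of_pos ht0, ← Real.exp_add, Real.exp_le_exp]
      have := mul_le_mul_of_nonneg_right hk2 hD
      have h2 : (Real.log t / Real.log 5 + 1) * D = D + Real.log t * (D / Real.log 5) := by ring
      linarith
  -- The indicator norm only grows under dilation, so the denominators need no quantitative bound.
  rw [ENNReal.div_eq_inv_mul, ENNReal.div_eq_inv_mul, mul_left_comm]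
  refine mul_le_mul' (ENNReal.inv_le_inv.2 ?_) h1
  exact varNorm_indicator_mono hR.pos (cube_mono x (by nlinarith))

theorem IsScalarApInfty.exists_lower (hn : 1 ≤ n) (hR : CubeRegular p a b C q) (hA : 0 ≤ A) :
    ∃ K d : ℝ, 0 ≤ d ∧ d < n / a ∧ ∀ w, IsScalarApInfty p A w → ∀ x l t, 0 < l → 1 ≤ t →
      varNorm p ((cube x l).indicator w) / varNorm p ((cube x l).indicator fun _ => 1) ≤
        ENNReal.ofReal (Real.exp K * t ^ d) * (varNorm p ((cube x (t * l)).indicator w) /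
          varNorm p ((cube x (t * l)).indicator fun _ => 1)) := by
  obtain ⟨e, he, hrev⟩ := IsScalarApInfty.exists_reverse_doubling hn hR hA
  have ha := hR.lower_pos
  have hn0 : (0 : ℝ) < n := by exact_mod_cast hn
  have hlog5 : 0 < Real.log 5 := Real.log_pos (by norm_num)
  -- The indicators cost `t^{n/a}`, and iterated reverse doubling gains `t^{-e / log 5}`. The
  -- maximum covers a gain larger than `n / a`.
  refine ⟨e + (Real.log C / a + (1 / a + n * C)), max 0 (n / a - e / Real.log 5), le_max_left _ _,
    max_lt (by positivity) (sub_lt_self _ (by positivity)), fun w hw x l t hl ht => ?_⟩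
  have ht0 : 0 < t := by linarith
  have hlogt : 0 ≤ Real.log t := Real.log_nonneg ht
  have iter : ∀ k : ℕ, varNorm p ((cube x l).indicator w) ≤
      ENNReal.ofReal (Real.exp (-(k * e))) * varNorm p ((cube x (5 ^ k * l)).indicator w) := by
    intro k
    induction k with
    | zero => simp
    | succ k ih =>
      have h1 := hrev w hw x (5 ^ k * l) (by positivity)
      rw [← mul_assoc 5, ← pow_succ'] at h1
      refine ih.trans ((mul_le_mul_right h1 _).trans (le_of_eq ?_))
      rw [← mul_assoc, ← ENNReal.ofReal_mul (Real.exp_pos _).le, ← Real.exp_add]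
      congr 3
      push_cast
      ring
  have hk1 : 5 ^ ⌊Real.log t / Real.log 5⌋₊ ≤ t := by
    rw [← Real.log_le_log_iff (by positivity) ht0, Real.log_pow, ← le_div_iff₀ hlog5]
    exact Nat.floor_le (by positivity)
  have hk2 := (Nat.lt_floor_add_one (Real.log t / Real.log 5)).le
  have h1 : varNorm p ((cube x l).indicator w) ≤
      ENNReal.ofReal (Real.exp e * t ^ (-(e / Real.log 5))) *
        varNorm p ((cube x (t * l)).indicator w) := by
    refine (iter ⌊Real.log t / Real.log 5⌋₊).trans
      (mul_le_mul' (ENNReal.ofReal_le_ofReal ?_) (varNorm_indicator_mono hR.pos (cube_mono x ?_)))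
    · rw [Real.rpow_def_of_pos ht0, ← Real.exp_add, Real.exp_le_exp]
      have := mul_le_mul_of_nonneg_right hk2 he.le
      have h2 : Real.log t / Real.log 5 * e = Real.log t * (e / Real.log 5) := by ring
      linarith
    · gcongr
  have h2 := hR.varNorm_one_dilate_le x hl ht
  have h3 : (varNorm p ((cube x l).indicator fun _ => 1))⁻¹ ≤
      ENNReal.ofReal (Real.exp (Real.log C / a + (1 / a + n * C)) * t ^ (n / a)) *
        (varNorm p ((cube x (t * l)).indicator fun _ => 1))⁻¹ := by
    rw [← ENNReal.div_eq_inv_mul.trans (mul_comm _ _),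
      ENNReal.le_div_iff_mul_le (Or.inl (hR.varNorm_one_pos x (by positivity)))
        (Or.inl (hR.varNorm_one_ne_top x (by positivity)))]
    refine (mul_le_mul_right h2 _).trans (le_of_eq ?_)
    rw [mul_left_comm, ENNReal.inv_mul_cancel (hR.varNorm_one_pos x hl)
      (hR.varNorm_one_ne_top x hl), mul_one]
  rw [ENNReal.div_eq_inv_mul, ENNReal.div_eq_inv_mul]
  refine (mul_le_mul' h3 h1).trans ?_
  rw [mul_mul_mul_comm, ← ENNReal.ofReal_mul (by positivity)]
  refine mul_le_mul_left (ENNReal.ofReal_le_ofReal ?_) _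
  rw [mul_mul_mul_comm, ← Real.exp_add, ← Real.rpow_add ht0, add_comm e]
  gcongr
  · exact (sub_eq_add_neg _ _).symm.le.trans (le_max_right _ _)

end Scalar

/-! ### Lebesgue differentiation along cubes. -/

section Lebesgue

variable {n : ℕ}

theorem preimage_toLp_cube (z : Fin n → ℝ) {r : ℝ} (hr : 0 ≤ r) :
    WithLp.toLp 2 ⁻¹' cube (WithLp.toLp 2 z) (2 * r) = Metric.closedBall z r := by
  ext y
  simp only [cube, Set.mem_preimage, Set.mem_ofPred_eq, Metric.mem_closedBall, dist_pi_le_iff hr,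
    Real.dist_eq]
  refine forall_congr' fun i => ?_
  rw [mul_div_cancel_left₀ _ (two_ne_zero)]

/-- Lebesgue's differentiation theorem for concentric cubes. -/
theorem ae_tendsto_setAverage_cube {f : EuclideanSpace ℝ (Fin n) → ℝ}
    (hf : ∀ x l, 0 < l → IntegrableOn f (cube x l)) :
    ∀ᵐ x, Filter.Tendsto (fun t : ℝ => ⨍ y in cube x t⁻¹, f y) Filter.atTop (nhds (f x)) := by
  have hmp := PiLp.volume_preserving_toLp (Fin n)
  have hme : MeasurableEmbedding (WithLp.toLp 2 : (Fin n → ℝ) → EuclideanSpace ℝ (Fin n)) :=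
    (MeasurableEquiv.toLp 2 (Fin n → ℝ)).measurableEmbedding
  have hloc : LocallyIntegrable (fun z : Fin n → ℝ => f (WithLp.toLp 2 z)) := by
    intro z
    refine ⟨Metric.closedBall z 1, Metric.closedBall_mem_nhds z one_pos, ?_⟩
    rw [← preimage_toLp_cube z zero_le_one]
    exact (hmp.integrableOn_comp_preimage hme).2 (hf _ _ (by norm_num))
  -- Closed balls of the sup norm on `Fin n → ℝ` are cubes, so differentiation along balls there
  -- transfers through the measure-preserving `toLp`.
  have h1 := IsUnifLocDoublingMeasure.ae_tendsto_average (volume : Measure (Fin n → ℝ)) hloc 1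
  have h2 : ∀ᵐ z : Fin n → ℝ, Filter.Tendsto
      (fun t : ℝ => ⨍ y in cube (WithLp.toLp 2 z) t⁻¹, f y) Filter.atTop
        (nhds (f (WithLp.toLp 2 z))) := by
    filter_upwards [h1] with z hz
    have h3 := hz (l := Filter.atTop) (fun _ : ℝ => z) (fun t : ℝ => t⁻¹ / 2) (by
      refine tendsto_nhdsWithin_iff.2 ⟨?_, ?_⟩
      · simpa using tendsto_inv_atTop_zero.div_const (2 : ℝ)
      · filter_upwards [Filter.eventually_gt_atTop 0] with t ht
        simp only [Set.mem_Ioi]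
        positivity) (by
      filter_upwards [Filter.eventually_gt_atTop 0] with t ht
      exact Metric.mem_closedBall_self (by positivity))
    refine h3.congr' ?_
    filter_upwards [Filter.eventually_gt_atTop 0] with t ht
    rw [setAverage_eq, setAverage_eq, ← preimage_toLp_cube z (by positivity),
      hmp.setIntegral_preimage_emb hme f, Measure.real, hmp.measure_preimage
      (measurableSet_cube _ _).nullMeasurableSet, Measure.real, mul_div_cancel₀ _ (two_ne_zero)]
  have h5 : MeasurePreserving (WithLp.ofLp : EuclideanSpace ℝ (Fin n) → (Fin n → ℝ)) :=
    PiLp.volume_preserving_ofLp (Fin n)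
  exact h5.quasiMeasurePreserving.ae h2

end Lebesgue

/-! ### Measurability of the averaged norm. -/

section Measurability

variable {n m : ℕ} {p : EuclideanSpace ℝ (Fin n) → ℝ}

theorem opNorm_nonneg (A : Matrix (Fin m) (Fin m) ℂ) : 0 ≤ opNorm A := norm_nonneg _

theorem opNorm_mul_le (A B : Matrix (Fin m) (Fin m) ℂ) :
    opNorm (A * B) ≤ opNorm A * opNorm B := by
  unfold opNorm
  rw [map_mul]
  exact norm_mul_le _ _

theorem opNorm_smul (c : ℂ) (A : Matrix (Fin m) (Fin m) ℂ) : opNorm (c • A) = ‖c‖ * opNorm A := by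
  unfold opNorm
  rw [map_smul, norm_smul]

theorem opNorm_pos (hm : 1 ≤ m) {A : Matrix (Fin m) (Fin m) ℂ} (hA : IsUnit A) :
    0 < opNorm A := by
  have : NeZero m := ⟨by omega⟩
  refine norm_pos_iff.2 fun h => ?_
  rw [map_eq_zero_iff _ (EquivLike.injective _)] at h
  exact hA.ne_zero h

theorem continuous_opNorm :
    Continuous (opNorm : Matrix (Fin m) (Fin m) ℂ → ℝ) := by
  refine continuous_norm.comp ?_
  exact LinearMap.continuous_of_finiteDimensional
    ((Matrix.toEuclideanCLM (n := Fin m) (𝕜 := ℂ)).toAlgEquiv.toLinearMap)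

/-- The inverse is `det⁻¹` times the adjugate, also for singular matrices, where both conventions
give `0`. Only the scalar inversion fails to be continuous, and it is measurable. -/
theorem measurable_opNorm_mul_inv :
    Measurable fun z : (Fin m → Fin m → ℂ) × (Fin m → Fin m → ℂ) =>
      opNorm (Matrix.of z.1 * (Matrix.of z.2)⁻¹) := by
  have h1 : ∀ z : (Fin m → Fin m → ℂ) × (Fin m → Fin m → ℂ),
      opNorm (Matrix.of z.1 * (Matrix.of z.2)⁻¹) =
        ‖(Matrix.of z.2).det⁻¹‖ * opNorm (Matrix.of z.1 * (Matrix.of z.2).adjugate) := by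
    intro z
    rw [Matrix.inv_def, Ring.inverse_eq_inv', mul_smul_comm, opNorm_smul]
  simp only [h1]
  have hc1 : Continuous fun z : (Fin m → Fin m → ℂ) × (Fin m → Fin m → ℂ) => Matrix.of z.1 :=
    continuous_fst
  have hc2 : Continuous fun z : (Fin m → Fin m → ℂ) × (Fin m → Fin m → ℂ) => Matrix.of z.2 :=
    continuous_snd
  have h2 : Continuous fun z : (Fin m → Fin m → ℂ) × (Fin m → Fin m → ℂ) => (Matrix.of z.2).det :=
    hc2.matrix_det
  have h3 : Continuous fun z : (Fin m → Fin m → ℂ) × (Fin m → Fin m → ℂ) =>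
      opNorm (Matrix.of z.1 * (Matrix.of z.2).adjugate) :=
    continuous_opNorm.comp (hc1.mul hc2.matrix_adjugate)
  exact (h2.measurable.inv.norm).mul h3.measurable

/-- The modular decreases in the scale, so the sublevel sets of the norm are unions over rational
scales; each modular is measurable in the parameter by Tonelli. -/
theorem measurable_varNorm (hp0 : ∀ x, 0 < p x) (hp : Measurable p)
    {g : EuclideanSpace ℝ (Fin n) → EuclideanSpace ℝ (Fin n) → ℝ}
    (hg : Measurable fun z : EuclideanSpace ℝ (Fin n) × EuclideanSpace ℝ (Fin n) => g z.1 z.2) :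
    Measurable fun y => varNorm p (g y) := by
  refine measurable_of_Iio fun a => ?_
  have h1 : (fun y => varNorm p (g y)) ⁻¹' Set.Iio a =
      ⋃ s : {s : ℚ // (0 : ℝ) < s ∧ ENNReal.ofReal s < a},
        {y | modular p (fun x => g y x / (s : ℚ)) ≤ 1} := by
    ext y
    simp only [Set.mem_preimage, Set.mem_Iio, Set.mem_iUnion, Set.mem_ofPred_eq]
    constructor
    · intro h
      obtain ⟨c, ⟨s, hs, hm, rfl⟩, hsa⟩ := sInf_lt_iff.1 h
      obtain ⟨r, hr1, hr2⟩ : ∃ r : ℚ, s < r ∧ ENNReal.ofReal r < a := by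
        rcases eq_or_ne a ∞ with rfl | ha
        · obtain ⟨r, hr⟩ := exists_rat_gt s
          exact ⟨r, hr, ENNReal.ofReal_lt_top⟩
        · have h2 : s < a.toReal := (ENNReal.ofReal_lt_iff_lt_toReal hs.le ha).1 hsa
          obtain ⟨r, hr1, hr2⟩ := exists_rat_btwn h2
          exact ⟨r, hr1, (ENNReal.ofReal_lt_iff_lt_toReal (hs.trans hr1).le ha).2 hr2⟩
      exact ⟨⟨r, hs.trans hr1, hr2⟩, (modular_div_antitone hp0 hs hr1.le).trans hm⟩
    · rintro ⟨⟨s, hs, hsa⟩, hm⟩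
      exact (varNorm_le hs hm).trans_lt hsa
  rw [h1]
  refine MeasurableSet.iUnion fun s => ?_
  refine measurableSet_le ?_ measurable_const
  unfold modular
  refine Measurable.lintegral_prod_right'
    (f := fun z : EuclideanSpace ℝ (Fin n) × EuclideanSpace ℝ (Fin n) => ‖g z.1 z.2 / ((s : ℚ) : ℝ)‖ₑ ^ p z.2) ?_
  exact (hg.div_const _).enorm.pow (hp.comp measurable_snd)

variable {W : EuclideanSpace ℝ (Fin n) → Matrix (Fin m) (Fin m) ℂ}

theorem IsMatrixWeight.aemeasurable (hW : IsMatrixWeight W) :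
    AEMeasurable (fun x => (fun i j => W x i j : Fin m → Fin m → ℂ)) :=
  aemeasurable_pi_iff.2 fun i => aemeasurable_pi_iff.2 fun j =>
    (hW.locallyIntegrable i j).aestronglyMeasurable.aemeasurable

theorem IsMatrixWeight.aemeasurable_opNorm_mul (hW : IsMatrixWeight W)
    (M : Matrix (Fin m) (Fin m) ℂ) : AEMeasurable fun x => opNorm (W x * M) := by
  have h1 : Continuous fun z : Fin m → Fin m → ℂ => opNorm (Matrix.of z * M) := by
    have h2 : Continuous fun z : Fin m → Fin m → ℂ => Matrix.of z := continuous_id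
    exact continuous_opNorm.comp (h2.mul continuous_const)
  exact h1.measurable.comp_aemeasurable hW.aemeasurable

/-- `W` is replaced by a measurable representative in both variables: in `x` the norm sees only
almost everywhere classes, and in `y` the claim is itself almost everywhere. -/
theorem IsMatrixWeight.aemeasurable_avgNorm (hW : IsMatrixWeight W) (hp0 : ∀ x, 0 < p x)
    (hp : Measurable p) {Q : Set (EuclideanSpace ℝ (Fin n))} (hQ : MeasurableSet Q) :
    AEMeasurable (avgNorm p W Q) := by
  obtain ⟨V, hV, hVW⟩ := hW.aemeasurable
  have hVW' : ∀ᵐ x, W x = Matrix.of (V x) := hVW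
  unfold avgNorm
  refine AEMeasurable.div_const ?_ _
  obtain ⟨F, hF, hFm⟩ : ∃ F : (Fin m → Fin m → ℂ) → (Fin m → Fin m → ℂ) → ℝ,
      (∀ A B, F A B = opNorm (Matrix.of A * (Matrix.of B)⁻¹)) ∧
      Measurable fun z : (Fin m → Fin m → ℂ) × (Fin m → Fin m → ℂ) => F z.1 z.2 :=
    ⟨_, fun _ _ => rfl, measurable_opNorm_mul_inv⟩
  refine ⟨fun y => varNorm p (Q.indicator fun x => F (V x) (V y)), ?_, ?_⟩
  · refine measurable_varNorm hp0 hp ?_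
    have h1 : Measurable fun z : EuclideanSpace ℝ (Fin n) × EuclideanSpace ℝ (Fin n) =>
        F (V z.2) (V z.1) :=
      hFm.comp ((hV.comp measurable_snd).prodMk (hV.comp measurable_fst))
    exact h1.indicator (measurable_snd hQ)
  · filter_upwards [hVW'] with y hy
    refine le_antisymm ?_ ?_ <;> refine varNorm_mono hp0 (hVW'.mono fun x hx => le_of_eq ?_) <;>
      simp only [Set.indicator, hx, hy, hF]

end Measurability

/-! ### Reduction of matrix weights to scalar weights, and the three conclusions. -/

section MatrixWeights

variable {n m : ℕ} {p : EuclideanSpace ℝ (Fin n) → ℝ} {a b C A : ℝ}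
  {q : EuclideanSpace ℝ (Fin n) → ℝ → ℝ}
  {W : EuclideanSpace ℝ (Fin n) → Matrix (Fin m) (Fin m) ℂ}

/-- A zero norm makes every scale `s > 0` admissible, so the modular is at most `s ^ a` for all `s ≤
1` and hence vanishes. -/
theorem varNorm_eq_zero (hp0 : ∀ x, 0 < p x) (ha : 0 < a) (hpa : ∀ x, a ≤ p x)
    (hp : Measurable p) {f : EuclideanSpace ℝ (Fin n) → ℝ} (hf : AEMeasurable f)
    (h : varNorm p f = 0) : ∀ᵐ x, f x = 0 := by
  have h1 : ∀ s : ℝ, 0 < s → s ≤ 1 → modular p f ≤ ENNReal.ofReal (s ^ a) := by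
    intro s hs hs1
    have h2 := modular_le_one_of_lt hp0 (f := f) (s := s) (by rw [h]; simpa using hs)
    have h3 := modular_const_mul_le (f := fun x => f x / s) hp0 hs
      (fun x => Real.rpow_le_rpow_of_exponent_ge hs hs1 (hpa x))
    have h4 : (fun x => s * (f x / s)) = f := by
      ext x; field_simp
    rw [h4] at h3
    exact h3.trans (mul_le_of_le_one_right' h2)
  have h2 : modular p f = 0 := by
    refine le_antisymm ?_ zero_le
    have h3 : Filter.Tendsto (fun s : ℝ => ENNReal.ofReal (s ^ a)) (nhdsWithin 0 (Set.Ioi 0))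
        (nhds 0) := by
      have h4 : Filter.Tendsto (fun s : ℝ => ENNReal.ofReal (s ^ a)) (nhds 0)
          (nhds (ENNReal.ofReal ((0 : ℝ) ^ a))) :=
        (ENNReal.continuous_ofReal.tendsto _).comp
          (Real.continuousAt_rpow_const 0 a (Or.inr ha.le))
      rw [Real.zero_rpow ha.ne', ENNReal.ofReal_zero] at h4
      exact h4.mono_left nhdsWithin_le_nhds
    refine ge_of_tendsto h3 ?_
    filter_upwards [Ioc_mem_nhdsGT (zero_lt_one (α := ℝ))] with s hs
    exact h1 s hs.1 hs.2
  rw [modular, lintegral_eq_zero_iff' (hf.enorm.pow hp.aemeasurable)] at h2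
  filter_upwards [h2] with x hx
  have h3 : f x = 0 ∧ 0 < p x := by simpa [(hp0 x).le, (hp0 x).not_gt] using hx
  exact h3.1

/-- Submultiplicativity applied to `W(x)M = (W(x)W(y)⁻¹)(W(y)M)`. This is the bridge between the
matrix and the scalar conditions. -/
theorem varNorm_opNorm_mul_le (hp0 : ∀ x, 0 < p x) (hm : 1 ≤ m)
    (Q : Set (EuclideanSpace ℝ (Fin n))) {M : Matrix (Fin m) (Fin m) ℂ} (hM : IsUnit M)
    {y : EuclideanSpace ℝ (Fin n)} (hy : IsUnit (W y)) :
    varNorm p (Q.indicator fun x => opNorm (W x * M)) ≤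
      ENNReal.ofReal (opNorm (W y * M)) *
        varNorm p (Q.indicator fun x => opNorm (W x * (W y)⁻¹)) := by
  refine le_trans (varNorm_mono hp0 (Filter.Eventually.of_forall fun x => ?_))
    (varNorm_const_mul_le (opNorm_pos hm (hy.mul hM)))
  by_cases hx : x ∈ Q
  · simp only [hx, Set.indicator_of_mem]
    rw [abs_of_nonneg (opNorm_nonneg _),
      abs_of_nonneg (mul_nonneg (opNorm_nonneg _) (opNorm_nonneg _)), mul_comm]
    have h1 : W x * M = W x * (W y)⁻¹ * (W y * M) := by
      rw [mul_assoc, ← mul_assoc (W y)⁻¹, Matrix.nonsing_inv_mul _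
        ((Matrix.isUnit_iff_isUnit_det _).1 hy), one_mul]
    rw [h1]
    exact opNorm_mul_le _ _
  · simp [hx]

theorem ofReal_exp_le_avgNorm (hp0 : ∀ x, 0 < p x) (hm : 1 ≤ m)
    {Q : Set (EuclideanSpace ℝ (Fin n))} {M : Matrix (Fin m) (Fin m) ℂ} (hM : IsUnit M)
    {y : EuclideanSpace ℝ (Fin n)} (hy : IsUnit (W y)) {γ δ : ℝ}
    (hγ : varNorm p (Q.indicator fun x => opNorm (W x * M)) = ENNReal.ofReal (Real.exp γ))
    (hδ : varNorm p (Q.indicator fun _ => 1) = ENNReal.ofReal (Real.exp δ)) :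
    ENNReal.ofReal (Real.exp (γ - δ - Real.log (opNorm (W y * M)))) ≤ avgNorm p W Q y := by
  have h1 := varNorm_opNorm_mul_le hp0 hm Q hM hy
  have h2 := opNorm_pos hm (hy.mul hM)
  have h3 : ENNReal.ofReal (opNorm (W y * M)) ≠ 0 := by simpa using h2
  unfold avgNorm
  rw [hδ, ENNReal.le_div_iff_mul_le (Or.inl (by simpa using Real.exp_pos δ))
    (Or.inl ENNReal.ofReal_ne_top), ← ENNReal.mul_le_mul_iff_right h3 ENNReal.ofReal_ne_top]
  refine le_trans (le_of_eq ?_) h1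
  rw [hγ, ← ENNReal.ofReal_mul (Real.exp_pos _).le, ← ENNReal.ofReal_mul h2.le, Real.exp_sub,
    Real.exp_sub, Real.exp_log h2]
  congr 1
  field_simp

theorem exists_eq_ofReal_exp {r : ℝ≥0∞} (h0 : r ≠ 0) (h : r ≠ ∞) :
    ∃ γ : ℝ, r = ENNReal.ofReal (Real.exp γ) :=
  ⟨Real.log r.toReal, by rw [Real.exp_log (ENNReal.toReal_pos h0 h), ENNReal.ofReal_toReal h]⟩

/-- On every cube, the averaged norm of an `𝒜_{p(·),∞}` weight has an integrable logarithm. -/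
theorem exists_log_avgNorm (hm : 1 ≤ m) (hR : CubeRegular p a b C q) (hW : IsMatrixWeight W)
    (hA : apInftyConst p W ≤ ENNReal.ofReal (Real.exp A)) (x : EuclideanSpace ℝ (Fin n)) {l : ℝ}
    (hl : 0 < l) :
    (∃ h : EuclideanSpace ℝ (Fin n) → ℝ, IntegrableOn h (cube x l) ∧
      (∀ᵐ y ∂(volume.restrict (cube x l)),
        avgNorm p W (cube x l) y = ENNReal.ofReal (Real.exp (h y))) ∧
      ⨍ y in cube x l, h y ≤ A) ∧
    ∀ M : Matrix (Fin m) (Fin m) ℂ, IsUnit M →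
      (∃ γ : ℝ, varNorm p ((cube x l).indicator fun z => opNorm (W z * M)) =
        ENNReal.ofReal (Real.exp γ)) ∧
      ∃ g : EuclideanSpace ℝ (Fin n) → ℝ, IntegrableOn g (cube x l) ∧
        ∀ᵐ y ∂(volume.restrict (cube x l)), Real.log (opNorm (W y * M)) ≤ g y := by
  have ha := hR.lower_pos
  have hQm := measurableSet_cube x l
  have hQ : volume (cube x l) ≠ ∞ := volume_cube_ne_top x hl.le
  have hQ0 : volume (cube x l) ≠ 0 := by
    rw [volume_cube x hl.le]
    simpa using pow_pos hl n
  have hgm : geomMean (cube x l) (avgNorm p W (cube x l)) ≤ ENNReal.ofReal (Real.exp A) :=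
    le_trans (le_iSup₂_of_le x l (le_iSup (fun _ : 0 < l =>
      geomMean (cube x l) (avgNorm p W (cube x l))) hl)) hA
  have hgm' := hgm.trans_lt ENNReal.ofReal_lt_top
  have hfm : AEMeasurable (avgNorm p W (cube x l)) (volume.restrict (cube x l)) :=
    (hW.aemeasurable_avgNorm hR.pos hR.measurable hQm).restrict
  have hfin := ae_lt_top_of_geomMean_lt_top hQ hfm hgm'
  obtain ⟨δ, hδ⟩ := exists_eq_ofReal_exp (hR.varNorm_one_pos x hl) (hR.varNorm_one_ne_top x hl)
  have hinv := ae_restrict_of_ae (s := cube x l) hW.invertible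
  have hNe : (ae (volume.restrict (cube x l))).NeBot := by
    rw [ae_neBot]
    simpa [Measure.restrict_eq_zero] using hQ0
  have hM : ∀ M : Matrix (Fin m) (Fin m) ℂ, IsUnit M →
      (∃ γ : ℝ, varNorm p ((cube x l).indicator fun z => opNorm (W z * M)) =
        ENNReal.ofReal (Real.exp γ)) ∧
      ∃ g : EuclideanSpace ℝ (Fin n) → ℝ, IntegrableOn g (cube x l) ∧
        ∀ᵐ y ∂(volume.restrict (cube x l)), Real.log (opNorm (W y * M)) ≤ g y := by
    intro M hM
    have hwpos : ∀ᵐ y, 0 < opNorm (W y * M) :=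
      hW.invertible.mono fun y hy => opNorm_pos hm (hy.mul hM)
    have hwm := hW.aemeasurable_opNorm_mul M
    have htop : varNorm p ((cube x l).indicator fun z => opNorm (W z * M)) ≠ ∞ := by
      -- One point `y` with finite averaged norm and invertible `W y` is enough to bound the norm of
      -- every `‖W M‖`.
      obtain ⟨y, hy1, hy2⟩ := (hfin.and hinv).exists
      have h1 := varNorm_opNorm_mul_le hR.pos hm (cube x l) hM hy2
      refine (h1.trans_lt (ENNReal.mul_lt_top ENNReal.ofReal_lt_top (lt_top_iff_ne_top.2 ?_))).ne
      intro hcon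
      rw [avgNorm, hcon, ENNReal.top_div_of_ne_top (hR.varNorm_one_ne_top x hl)] at hy1
      exact hy1.ne rfl
    have hzero : varNorm p ((cube x l).indicator fun z => opNorm (W z * M)) ≠ 0 := by
      intro h0
      have h1 := varNorm_eq_zero hR.pos ha hR.lower_le hR.measurable (hwm.indicator hQm) h0
      obtain ⟨y, ⟨hy1, hy2⟩, hy3⟩ := (((ae_restrict_of_ae h1).and
        (ae_restrict_of_ae hwpos)).and (ae_restrict_mem hQm)).exists
      rw [Set.indicator_of_mem hy3] at hy1
      exact hy2.ne' hy1
    obtain ⟨γ, hγ⟩ := exists_eq_ofReal_exp hzero htop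
    refine ⟨⟨γ, hγ⟩, ?_⟩
    -- Any scale strictly above the norm has modular at most `1`. Then `log z ≤ z ^ p / a` with `z =
    -- ‖W M‖ / s` supplies the integrable majorant.
    have hs : 0 < Real.exp γ + 1 := by positivity
    have h1 := modular_le_one_of_lt hR.pos (s := Real.exp γ + 1) (by
      rw [hγ]
      exact (ENNReal.ofReal_lt_ofReal_iff hs).2 (by linarith))
    rw [modular_indicator hR.pos hQm] at h1
    have h2 := (rpow_integrable_and_integral_le hR.measurable hwm hwpos hs h1).1
    refine ⟨fun y => Real.log (Real.exp γ + 1) +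
      1 / a * (opNorm (W y * M) / (Real.exp γ + 1)) ^ p y,
      (integrableOn_const hQ).add (h2.const_mul _), ?_⟩
    filter_upwards [ae_restrict_of_ae hwpos] with y hy
    have h3 := Real.add_one_le_exp (p y * Real.log (opNorm (W y * M) / (Real.exp γ + 1)))
    have h4 : Real.exp (p y * Real.log (opNorm (W y * M) / (Real.exp γ + 1))) =
        (opNorm (W y * M) / (Real.exp γ + 1)) ^ p y := by
      rw [Real.rpow_def_of_pos (by positivity), mul_comm]
    rw [h4] at h3
    have hpy := hR.pos y
    have h5 : Real.log (opNorm (W y * M) / (Real.exp γ + 1)) ≤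
        1 / a * (opNorm (W y * M) / (Real.exp γ + 1)) ^ p y := by
      have hle := hR.lower_le y
      calc _ = 1 / p y * (p y * Real.log (opNorm (W y * M) / (Real.exp γ + 1))) := by
            field_simp
        _ ≤ 1 / p y * (opNorm (W y * M) / (Real.exp γ + 1)) ^ p y := by
            gcongr
            linarith
        _ ≤ _ := by gcongr
    rw [Real.log_div hy.ne' hs.ne'] at h5
    linarith
  refine ⟨?_, hM⟩
  -- The majorant of `log ‖W‖` gives an integrable minorant of the logarithm of the averaged norm,
  -- so its negative part is integrable too.
  obtain ⟨⟨γ, hγ⟩, g, hg, hgle⟩ := hM 1 isUnit_one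
  obtain ⟨h, hh, hfh⟩ := exists_integrableOn_of_geomMean_lt_top (g := fun y => γ - δ - g y) hQ hfm
    ((integrableOn_const hQ).sub hg) (by
      filter_upwards [hgle, hinv] with y hy1 hy2
      refine le_trans (ENNReal.ofReal_le_ofReal (Real.exp_le_exp.2 ?_))
        (ofReal_exp_le_avgNorm hR.pos hm isUnit_one hy2 hγ hδ)
      linarith) hgm'
  refine ⟨h, hh, hfh, ?_⟩
  have h1 := (geomMean_mono (hfh.mono fun y hy => hy.symm.le)).trans hgm
  rw [geomMean_ofReal_exp hQ0 hh, ENNReal.ofReal_le_ofReal_iff (Real.exp_pos _).le,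
    Real.exp_le_exp] at h1
  exact h1

/-- The scalar weights `‖W M‖` inherit the `𝒜_{p(·),∞}` condition, uniformly in `M`. -/
theorem isScalarApInfty_opNorm_mul (hm : 1 ≤ m) (hR : CubeRegular p a b C q)
    (hW : IsMatrixWeight W) (hA : apInftyConst p W ≤ ENNReal.ofReal (Real.exp A))
    {M : Matrix (Fin m) (Fin m) ℂ} (hM : IsUnit M) :
    IsScalarApInfty p A fun y => opNorm (W y * M) := by
  have hwm := hW.aemeasurable_opNorm_mul M
  have key : ∀ x l, 0 < l → IntegrableOn (fun y => Real.log (opNorm (W y * M))) (cube x l) ∧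
      varNorm p ((cube x l).indicator fun y => opNorm (W y * M)) ≤
      ENNReal.ofReal (Real.exp (A + ⨍ y in cube x l, Real.log (opNorm (W y * M)))) *
        varNorm p ((cube x l).indicator fun _ => 1) := by
    intro x l hl
    have hQ : volume (cube x l) ≠ ∞ := volume_cube_ne_top x hl.le
    obtain ⟨⟨h, hh, hfh, hhA⟩, hMM⟩ := exists_log_avgNorm hm hR hW hA x hl
    obtain ⟨⟨γ, hγ⟩, g, hg, hgle⟩ := hMM M hM
    obtain ⟨δ, hδ⟩ := exists_eq_ofReal_exp (hR.varNorm_one_pos x hl) (hR.varNorm_one_ne_top x hl)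
    have hle : ∀ᵐ y ∂(volume.restrict (cube x l)),
        γ - δ - Real.log (opNorm (W y * M)) ≤ h y := by
      filter_upwards [hfh, ae_restrict_of_ae hW.invertible] with y hy1 hy2
      have h1 := ofReal_exp_le_avgNorm hR.pos hm hM hy2 hγ hδ
      rwa [hy1, ENNReal.ofReal_le_ofReal_iff (Real.exp_pos _).le, Real.exp_le_exp] at h1
    have hint : IntegrableOn (fun y => Real.log (opNorm (W y * M))) (cube x l) := by
      have h2 : IntegrableOn (fun y => γ - δ - h y) (cube x l) := (integrableOn_const hQ).sub hh
      refine Integrable.mono' (g := fun y => |g y| + |γ - δ - h y|) (hg.abs.add h2.abs)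
        (Real.measurable_log.comp_aemeasurable hwm.restrict).aestronglyMeasurable ?_
      filter_upwards [hgle, hle] with y hy1 hy2
      rw [Real.norm_eq_abs, abs_le]
      constructor
      · linarith [neg_abs_le (γ - δ - h y), abs_nonneg (g y)]
      · linarith [le_abs_self (g y), abs_nonneg (γ - δ - h y)]
    refine ⟨hint, ?_⟩
    -- Averaging the pointwise bound `γ - δ - log ‖W M‖ ≤ h`, where `h` has mean at most `A`, is
    -- exactly the scalar condition.
    have h3 : γ - δ ≤ A + ⨍ y in cube x l, Real.log (opNorm (W y * M)) := by
      have h4 := setIntegral_mono_ae_restrict ((integrableOn_const hQ).sub hint) hh hle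
      have hv : 0 < volume.real (cube x l) := by
        rw [volume_real_cube x hl.le]; positivity
      rw [setAverage_eq, smul_eq_mul] at hhA ⊢
      have h5 : ∫ y in cube x l, (γ - δ - Real.log (opNorm (W y * M))) =
          volume.real (cube x l) * (γ - δ) - ∫ y in cube x l, Real.log (opNorm (W y * M)) := by
        have hc : IntegrableOn (fun _ => γ - δ) (cube x l) volume := integrableOn_const hQ
        rw [integral_sub hc hint, setIntegral_const, smul_eq_mul]
      have h6 : (volume.real (cube x l))⁻¹ * (volume.real (cube x l) * (γ - δ) -
          ∫ y in cube x l, Real.log (opNorm (W y * M))) ≤ A := by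
        refine le_trans ?_ hhA
        gcongr
        exact h5.symm.le.trans h4
      rw [mul_sub, inv_mul_cancel_left₀ hv.ne'] at h6
      linarith
    rw [hγ, hδ, ← ENNReal.ofReal_mul (Real.exp_pos _).le, ← Real.exp_add]
    exact ENNReal.ofReal_le_ofReal (Real.exp_le_exp.2 (by linarith))
  exact ⟨hwm, hW.invertible.mono fun y hy => opNorm_pos hm (hy.mul hM), fun x l hl => (key x l hl).1,
    fun x l hl => (key x l hl).2⟩

theorem exists_apInftyConst_le (hW : W ∈ ApInfty m p) :
    ∃ A, 0 ≤ A ∧ apInftyConst p W ≤ ENNReal.ofReal (Real.exp A) := by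
  refine ⟨(apInftyConst p W).toReal, ENNReal.toReal_nonneg, ?_⟩
  rw [ENNReal.le_ofReal_iff_toReal_le hW.2.ne (Real.exp_pos _).le]
  linarith [Real.add_one_le_exp (apInftyConst p W).toReal]

/-- A pointwise comparison of averaged norms gives a comparison of their geometric means. -/
theorem geomMean_avgNorm_le (hm : 1 ≤ m) (hR : CubeRegular p a b C q) (hW : IsMatrixWeight W)
    (hA : apInftyConst p W ≤ ENNReal.ofReal (Real.exp A)) (x : EuclideanSpace ℝ (Fin n)) {l : ℝ}
    (hl : 0 < l) {S : Set (EuclideanSpace ℝ (Fin n))} {c : ℝ} (hc : 0 < c)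
    (h : ∀ y, IsUnit (W y) → avgNorm p W S y ≤ ENNReal.ofReal c * avgNorm p W (cube x l) y) :
    geomMean (cube x l) (avgNorm p W S) ≤ ENNReal.ofReal (Real.exp A * c) := by
  have hQ : volume (cube x l) ≠ ∞ := volume_cube_ne_top x hl.le
  have hQ0 : volume (cube x l) ≠ 0 := by
    rw [volume_cube x hl.le]
    simpa using pow_pos hl n
  obtain ⟨⟨g, hg, hfg, hgA⟩, -⟩ := exists_log_avgNorm hm hR hW hA x hl
  have hi : IntegrableOn (fun y => Real.log c + g y) (cube x l) := (integrableOn_const hQ).add hg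
  refine (geomMean_mono (g := fun y => ENNReal.ofReal (Real.exp (Real.log c + g y))) ?_).trans ?_
  · filter_upwards [hfg, ae_restrict_of_ae hW.invertible] with y hy1 hy2
    rw [Real.exp_add, Real.exp_log hc, ENNReal.ofReal_mul hc.le, ← hy1]
    exact h y hy2
  · rw [geomMean_ofReal_exp hQ0 hi]
    refine ENNReal.ofReal_le_ofReal ?_
    have h1 : ⨍ y in cube x l, (Real.log c + g y) = Real.log c + ⨍ y in cube x l, g y := by
      have hv : 0 < volume.real (cube x l) := by
        rw [volume_real_cube x hl.le]; positivity
      have hc' : IntegrableOn (fun _ => Real.log c) (cube x l) volume := integrableOn_const hQ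
      rw [setAverage_eq, setAverage_eq, integral_add hc' hg, setIntegral_const]
      simp only [smul_eq_mul]
      field_simp
    rw [h1, Real.exp_add, Real.exp_log hc, mul_comm]
    gcongr

theorem mem_apInfty_of_geomMean_le (hW : IsMatrixWeight W) {c : ℝ}
    (h : ∀ x l, 0 < l → geomMean (cube x l) (avgNorm p W (cube x l)) ≤ ENNReal.ofReal c) :
    W ∈ ApInfty m p :=
  ⟨hW, (iSup_le fun x => iSup_le fun l => iSup_le fun hl => h x l hl).trans_lt
    ENNReal.ofReal_lt_top⟩

/-- Lower bound for the geometric mean over one cube of the averaged norm over another cube. -/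
theorem le_geomMean_avgNorm (hm : 1 ≤ m) (hR : CubeRegular p a b C q) (hW : IsMatrixWeight W)
    (hw : IsScalarApInfty p A fun y => opNorm (W y * 1)) (x : EuclideanSpace ℝ (Fin n)) {l : ℝ}
    (hl : 0 < l) {S : Set (EuclideanSpace ℝ (Fin n))} {γ δ : ℝ}
    (hγ : varNorm p (S.indicator fun x => opNorm (W x * 1)) = ENNReal.ofReal (Real.exp γ))
    (hδ : varNorm p (S.indicator fun _ => 1) = ENNReal.ofReal (Real.exp δ)) :
    ENNReal.ofReal (Real.exp (γ - δ - ⨍ y in cube x l, Real.log (opNorm (W y * 1)))) ≤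
      geomMean (cube x l) (avgNorm p W S) := by
  have hQ : volume (cube x l) ≠ ∞ := volume_cube_ne_top x hl.le
  have hQ0 : volume (cube x l) ≠ 0 := by
    rw [volume_cube x hl.le]
    simpa using pow_pos hl n
  have hint := hw.integrableOn_log x l hl
  have hi : IntegrableOn (fun y => γ - δ - Real.log (opNorm (W y * 1))) (cube x l) :=
    (integrableOn_const hQ).sub hint
  have h1 : γ - δ - ⨍ y in cube x l, Real.log (opNorm (W y * 1)) =
      ⨍ y in cube x l, (γ - δ - Real.log (opNorm (W y * 1))) := by
    have hv : 0 < volume.real (cube x l) := by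
      rw [volume_real_cube x hl.le]; positivity
    have hc : IntegrableOn (fun _ => γ - δ) (cube x l) volume := integrableOn_const hQ
    rw [setAverage_eq, setAverage_eq, integral_sub hc hint, setIntegral_const]
    simp only [smul_eq_mul]
    field_simp
  rw [h1, ← geomMean_ofReal_exp hQ0 hi]
  refine geomMean_mono ?_
  filter_upwards [ae_restrict_of_ae hW.invertible] with y hy
  exact ofReal_exp_le_avgNorm hR.pos hm isUnit_one hy hγ hδ

/-- The left sides tend to `exp L > 0` and the right sides to `0`. -/
theorem false_of_tendsto_exp_le {F : ℝ → ℝ} {L c d : ℝ} (hd : d < 0)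
    (hF : Filter.Tendsto F Filter.atTop (nhds L))
    (h : ∀ t, 1 ≤ t → ENNReal.ofReal (Real.exp (F t)) ≤ ENNReal.ofReal (c * t ^ d)) : False := by
  have h1 : Filter.Tendsto (fun t : ℝ => c * t ^ d) Filter.atTop (nhds (c * 0)) := by
    refine Filter.Tendsto.const_mul c ?_
    have := tendsto_rpow_neg_atTop (neg_pos.2 hd)
    simpa using this
  have h2 := (ENNReal.continuous_ofReal.tendsto _).comp h1
  have h3 := (ENNReal.continuous_ofReal.tendsto _).comp ((Real.continuous_exp.tendsto _).comp hF)
  have h4 := le_of_tendsto_of_tendsto h3 h2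
    ((Filter.eventually_ge_atTop 1).mono fun t ht => h t ht)
  rw [mul_zero, ENNReal.ofReal_zero, nonpos_iff_eq_zero, ENNReal.ofReal_eq_zero] at h4
  exact h4.not_gt (Real.exp_pos L)

/-- The geometric mean is over the unit cube at a Lebesgue point `x` of `log ‖W‖`, the norm over the
cube of edge `t⁻¹`. Jensen bounds the normalized norm below by a multiple of `exp(⨍ log ‖W‖)` over
the shrinking cube, which converges. -/
theorem LowerDim_eq_empty (hm : 1 ≤ m) (hR : CubeRegular p a b C q) {d : ℝ} (hd : d < 0) :
    LowerDim m p d = ∅ := by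
  refine Set.eq_empty_of_forall_notMem ?_
  rintro W ⟨hW, c, -, h⟩
  have hAp : W ∈ ApInfty m p := mem_apInfty_of_geomMean_le hW (c := c) fun x l hl => by
    simpa using h 1 x l le_rfl hl
  obtain ⟨A, -, hA⟩ := exists_apInftyConst_le hAp
  have hw := isScalarApInfty_opNorm_mul hm hR hW hA isUnit_one
  obtain ⟨x, hx⟩ := (ae_tendsto_setAverage_cube hw.integrableOn_log).exists
  refine false_of_tendsto_exp_le (c := c) hd ((hx.sub_const
    ((1 / a + n * C) / 1 + Real.log C / a)).sub_const
      (⨍ y in cube x 1, Real.log (opNorm (W y * 1)))) fun t ht => ?_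
  have ht0 : 0 < t⁻¹ := by positivity
  have h1 := h t x t⁻¹ ht ht0
  rw [mul_inv_cancel₀ (by positivity)] at h1
  refine le_trans ?_ h1
  obtain ⟨γ, hγ⟩ := hw.exists_varNorm_eq hR x ht0
  obtain ⟨δ, hδ⟩ := exists_eq_ofReal_exp (hR.varNorm_one_pos x ht0) (hR.varNorm_one_ne_top x ht0)
  refine le_trans (ENNReal.ofReal_le_ofReal (Real.exp_le_exp.2 ?_))
    (le_geomMean_avgNorm hm hR hW hw x one_pos hγ hδ)
  have h2 := hR.exp_setAverage_log_le_varNorm ht0 one_pos (measurableSet_cube x t⁻¹) subset_rfl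
    (by rw [volume_real_cube x ht0.le, one_mul]) hw.aemeasurable hw.pos
    (hw.integrableOn_log x t⁻¹ ht0)
  have h3 := hR.varNorm_one_le x ht0
  rw [hγ, ENNReal.ofReal_le_ofReal_iff (Real.exp_pos _).le, Real.exp_le_exp] at h2
  rw [hδ, ENNReal.ofReal_le_ofReal_iff (Real.exp_pos _).le, Real.exp_le_exp] at h3
  linarith

/-- Here the norm is over the fixed unit cube and the averaging cube shrinks, so convergence of the
means of `log ‖W‖` at a Lebesgue point suffices. -/
theorem UpperDim_eq_empty (hm : 1 ≤ m) (hR : CubeRegular p a b C q) {d : ℝ} (hd : d < 0) :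
    UpperDim m p d = ∅ := by
  refine Set.eq_empty_of_forall_notMem ?_
  rintro W ⟨hW, c, -, h⟩
  have hAp : W ∈ ApInfty m p := mem_apInfty_of_geomMean_le hW (c := c) fun x l hl => by
    simpa using h 1 x l le_rfl hl
  obtain ⟨A, -, hA⟩ := exists_apInftyConst_le hAp
  have hw := isScalarApInfty_opNorm_mul hm hR hW hA isUnit_one
  obtain ⟨x, hx⟩ := (ae_tendsto_setAverage_cube hw.integrableOn_log).exists
  obtain ⟨γ, hγ⟩ := hw.exists_varNorm_eq hR x one_pos
  obtain ⟨δ, hδ⟩ := exists_eq_ofReal_exp (hR.varNorm_one_pos x one_pos)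
    (hR.varNorm_one_ne_top x one_pos)
  refine false_of_tendsto_exp_le (c := c) hd (hx.const_sub (γ - δ)) fun t ht => ?_
  have ht0 : 0 < t⁻¹ := by positivity
  have h1 := h t x t⁻¹ ht ht0
  rw [mul_inv_cancel₀ (by positivity)] at h1
  exact le_trans (le_geomMean_avgNorm hm hR hW hw x ht0 hγ hδ) h1

theorem exists_mem_LowerDim (hn : 1 ≤ n) (hm : 1 ≤ m) (hR : CubeRegular p a b C q)
    (hW : W ∈ ApInfty m p) : ∃ d ∈ Set.Ico (0 : ℝ) (n / a), W ∈ LowerDim m p d := by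
  obtain ⟨A, hA0, hA⟩ := exists_apInftyConst_le hW
  obtain ⟨K, d, hd0, hd, h⟩ := IsScalarApInfty.exists_lower hn hR hA0
  refine ⟨d, ⟨hd0, hd⟩, hW.1, Real.exp A * Real.exp K, by positivity, fun t x l ht hl => ?_⟩
  have ht0 : 0 < t := by linarith
  rw [mul_assoc]
  refine geomMean_avgNorm_le hm hR hW.1 hA x (by positivity) (by positivity) fun y hy => ?_
  -- The scalar weight depends on `y` through `M = (W y)⁻¹`; the scalar constants depend only on `A`
  -- and the exponent, so the bound is uniform in `y`.
  exact h _ (isScalarApInfty_opNorm_mul hm hR hW.1 hA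
    (Matrix.isUnit_nonsing_inv_iff.2 hy)) x l t hl ht

theorem exists_mem_UpperDim (hn : 1 ≤ n) (hm : 1 ≤ m) (hR : CubeRegular p a b C q)
    (hW : W ∈ ApInfty m p) : ∃ d ∈ Set.Ici (0 : ℝ), W ∈ UpperDim m p d := by
  obtain ⟨A, hA0, hA⟩ := exists_apInftyConst_le hW
  obtain ⟨K, d, hd0, h⟩ := IsScalarApInfty.exists_upper hn hR hA0
  refine ⟨d, hd0, hW.1, Real.exp A * Real.exp K, by positivity, fun t x l ht hl => ?_⟩
  have ht0 : 0 < t := by linarith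
  rw [mul_assoc]
  refine geomMean_avgNorm_le hm hR hW.1 hA x hl (by positivity) fun y hy => ?_
  exact h _ (isScalarApInfty_opNorm_mul hm hR hW.1 hA
    (Matrix.isUnit_nonsing_inv_iff.2 hy)) x l t hl ht

end MatrixWeights

theorem proposition3p18 (n m : ℕ) (hn : 1 ≤ n) (hm : 1 ≤ m)
    (p : EuclideanSpace ℝ (Fin n) → ℝ) (hp : IsExponentP0 p) (hLH : IsLH p) :
    (∀ d : ℝ, d < 0 → LowerDim m p d = ∅ ∧ UpperDim m p d = ∅) ∧
    (∀ W ∈ ApInfty m p, ∃ d₁ ∈ Set.Ico (0 : ℝ) ((n : ℝ) / essInf p volume),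
      W ∈ LowerDim m p d₁) ∧
    (∀ W ∈ ApInfty m p, ∃ d₂ ∈ Set.Ici (0 : ℝ), W ∈ UpperDim m p d₂) := by
  obtain ⟨b, C, q, hR⟩ := hp.exists_cubeRegular hn hLH
  exact ⟨fun d hd => ⟨LowerDim_eq_empty hm hR hd, UpperDim_eq_empty hm hR hd⟩,
    fun W hW => exists_mem_LowerDim hn hm hR hW, fun W hW => exists_mem_UpperDim hn hm hR hW⟩
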